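/- Let $r\ge 2$, $m\ge 0$ be integers and let $X\subset\mathbb P^r$ be a smooth connected complete intersection defined over the finite field $\mathbb F_q$. Let $G$ be a divisor on $X$, let $P_1,\dots,P_n$ be distinct $\mathbb F_q$-rational points of $X$ that do not lie on the support of $G$, and put $D=P_1+\dots+P_n$. Let $L(G)$ be the space of rational functions $z$ on $X$ with $z=0$ or $\operatorname{div} z+G\ge 0$, let $C(D,G)=\{(z(P_1),\dots,z(P_n)) : z\in L(G)\}\subseteq\mathbb F_q^n$ and let $C(D,G)^*$ be its dual code. Assume that $L(G)\supseteq H^0(\mathbb P^r,\mathcal O_{\mathbb P^r}(m))$, where forms $h$ of degree $m$ are regarded as rational functions $h/\sigma$ on $X$ by means of a rational section $\sigma$ of $\mathcal O_X(m)$ that is regular and non-zero at every $P_i$ (for example $\sigma=x_0^m$ if the $P_i$ lie in the affine chart $x_0\ne 0$, so that one gets the polynomials of degree at most $m$ in the affine coordinates). Let $d$ be the minimum distance of $C(D,G)^*$ and let $S=\{P_{i_1},\dots,P_{i_d}\}$ be the set of points in the support of a minimum weight codeword of $C(D,G)^*$. (i) If $d\le m+2$, then $d=m+2$ and all the points of $S$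 are collinear in $\mathbb P^r$. (ii) If $d\le 2m+2$ and no $m+2$ of the points of $S$ are collinear, then $d=2m+2$ and all the points of $S$ lie on a plane conic. (iii) If $d\le 3m$, no $m+2$ of the points of $S$ are collinear and no $2m+2$ of them lie on a plane conic, then $d=3m$ and all the points of $S$ lie on the intersection of two coplanar plane curves of respective degrees $3$ and $m$ without common component. Here conics and plane curves are defined over $\mathbb F_q$ and may be reducible or non-reduced. -/

import Mathlib

open scoped LinearAlgebra.Projectivization

noncomputable section

namespace DualAGCode

attribute [local instance] MvPolynomial.gradedAlgebra

/-! ### Complete intersections in projective space -/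

/-- `X = V(f₁, …, f_c) ⊆ ℙ^r` is a smooth connected complete intersection over the field `F`, cut
out by the forms `f₁, …, f_c` of positive degree: smoothness of dimension `r - c` is the Jacobian
criterion at all points of `X` over an algebraic closure, and connectedness refers to the Zariski
topology of the scheme `X` (a connected set is non-empty). -/
structure IsSmoothConnectedCI {F : Type*} [Field F] {r c : ℕ}
    (f : Fin c → MvPolynomial (Fin (r + 1)) F) : Prop where
  homogeneous : ∀ j, ∃ e : ℕ, 0 < e ∧ (f j).IsHomogeneous e
  smooth : ∀ x : Fin (r + 1) → AlgebraicClosure F, x ≠ 0 →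
    (∀ j, MvPolynomial.aeval x (f j) = 0) →
    LinearIndependent (AlgebraicClosure F)
      (fun (j : Fin c) (i : Fin (r + 1)) => MvPolynomial.aeval x (MvPolynomial.pderiv i (f j)))
  connected : IsConnected (ProjectiveSpectrum.zeroLocus
    (MvPolynomial.homogeneousSubmodule (Fin (r + 1)) F) (Set.range f))

/-- The homogeneous coordinate ring of `X = V(f)`. -/
abbrev CoordRing {F : Type*} [Field F] {r c : ℕ}
    (f : Fin c → MvPolynomial (Fin (r + 1)) F) : Type _ :=
  MvPolynomial (Fin (r + 1)) F ⧸ Ideal.span (Set.range f)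

/-- The class of a polynomial in the coordinate ring. -/
abbrev toCoord {F : Type*} [Field F] {r c : ℕ} (f : Fin c → MvPolynomial (Fin (r + 1)) F) :
    MvPolynomial (Fin (r + 1)) F →+* CoordRing f :=
  Ideal.Quotient.mk (Ideal.span (Set.range f))

/-- The value of a polynomial at the chosen homogeneous coordinate vector of a rational point. Only
its vanishing, and quotients of values of forms of equal degree, are independent of that choice. -/
def evalAt {F : Type*} [Field F] {N : ℕ} (P : ℙ F (Fin N → F)) (a : MvPolynomial (Fin N) F) : F :=
  MvPolynomial.eval P.rep a

/-- The rational point `P` of projective space lies on `X = V(f)`. -/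
def IsPointOf {F : Type*} [Field F] {r c : ℕ} (f : Fin c → MvPolynomial (Fin (r + 1)) F)
    (P : ℙ F (Fin (r + 1) → F)) : Prop :=
  ∀ j, evalAt P (f j) = 0

/-! ### Divisors -/

/-- A prime divisor of `X`: a relevant homogeneous prime of height one of the coordinate ring. -/
structure PrimeDivisor {F : Type*} [Field F] {r c : ℕ}
    (f : Fin c → MvPolynomial (Fin (r + 1)) F) where
  toIdeal : Ideal (CoordRing f)
  isPrime : toIdeal.IsPrime
  isHomogeneous : (toIdeal.comap (toCoord f)).IsHomogeneous
    (MvPolynomial.homogeneousSubmodule (Fin (r + 1)) F)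
  relevant : ∃ i, toCoord f (MvPolynomial.X i) ∉ toIdeal
  height_eq_one : toIdeal.height = 1

attribute [instance] PrimeDivisor.isPrime

/-- Divisors on `X`: finite integral combinations of prime divisors. -/
abbrev Divisor {F : Type*} [Field F] {r c : ℕ}
    (f : Fin c → MvPolynomial (Fin (r + 1)) F) : Type _ :=
  PrimeDivisor f →₀ ℤ

/-- The rational point `P` does not lie on the support of the divisor `G`. -/
def Avoids {F : Type*} [Field F] {r c : ℕ} {f : Fin c → MvPolynomial (Fin (r + 1)) F}
    (P : ℙ F (Fin (r + 1) → F)) (G : Divisor f) : Prop :=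
  ∀ W : PrimeDivisor f, G W ≠ 0 → ∃ a, toCoord f a ∈ W.toIdeal ∧ evalAt P a ≠ 0

/-- The order of vanishing along the prime divisor `W` of a form `a` that is non-zero on `X`,
computed in the local ring of the affine cone along `W`. -/
def ordForm {F : Type*} [Field F] {r c : ℕ} {f : Fin c → MvPolynomial (Fin (r + 1)) F}
    (W : PrimeDivisor f) (a : MvPolynomial (Fin (r + 1)) F) : ℤ :=
  ((Ring.ord (Localization.AtPrime W.toIdeal)
    (algebraMap (CoordRing f) (Localization.AtPrime W.toIdeal) (toCoord f a))).toNat : ℤ)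

/-! ### Rational functions and the spaces `L(G)` -/

/-- `z = a / b`, with `a`, `b` forms of the same degree, `b` not a zero divisor on `X`. The elements
`z` of the total ring of fractions of the coordinate ring that admit such a representation are the
rational functions on `X`. -/
def IsFraction {F : Type*} [Field F] {r c : ℕ} (f : Fin c → MvPolynomial (Fin (r + 1)) F)
    (z : FractionRing (CoordRing f)) (a b : MvPolynomial (Fin (r + 1)) F) : Prop :=
  ∃ k : ℕ, a.IsHomogeneous k ∧ b.IsHomogeneous k ∧ toCoord f b ∈ nonZeroDivisors (CoordRing f) ∧
    z * algebraMap (CoordRing f) (FractionRing (CoordRing f)) (toCoord f b) =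
      algebraMap (CoordRing f) (FractionRing (CoordRing f)) (toCoord f a)

/-- The rational function `z` is regular at the rational point `P`, with value `v`. -/
def HasValueAt {F : Type*} [Field F] {r c : ℕ} (f : Fin c → MvPolynomial (Fin (r + 1)) F)
    (z : FractionRing (CoordRing f)) (P : ℙ F (Fin (r + 1) → F)) (v : F) : Prop :=
  ∃ a b, IsFraction f z a b ∧ evalAt P b ≠ 0 ∧ v = evalAt P a / evalAt P b

/-- `L(G)`: the rational functions `z = a / b` on `X` with `z = 0` or `div z + G ≥ 0`, where the
coefficient of `div z` at `W` is `ord_W a - ord_W b`. -/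
def riemannRoch {F : Type*} [Field F] {r c : ℕ} {f : Fin c → MvPolynomial (Fin (r + 1)) F}
    (G : Divisor f) : Set (FractionRing (CoordRing f)) :=
  {z | ∃ a b, IsFraction f z a b ∧
    (z = 0 ∨ ∀ W : PrimeDivisor f, 0 ≤ ordForm W a - ordForm W b + G W)}

/-- `L(G) ⊇ H⁰(ℙ^r, 𝒪(m))`, compatibly with evaluation at the points `P i`: for some rational
section `s / t` of `𝒪_X(m)` (with `s`, `t` forms, `deg s = deg t + m`), regular and non-vanishing
at every `P i`, the rational functions `h / (s / t)` belong to `L(G)` for all forms `h` of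
degree `m`. For `s = x₀ ^ m` and `t = 1` these are the polynomials of degree at most `m` in the
affine coordinates `xᵢ / x₀`. -/
def ContainsForms {F : Type*} [Field F] {r c n : ℕ} {f : Fin c → MvPolynomial (Fin (r + 1)) F}
    (P : Fin n → ℙ F (Fin (r + 1) → F)) (G : Divisor f) (m : ℕ) : Prop :=
  ∃ (k : ℕ) (s t : MvPolynomial (Fin (r + 1)) F),
    s.IsHomogeneous (k + m) ∧ t.IsHomogeneous k ∧
    toCoord f s ∈ nonZeroDivisors (CoordRing f) ∧ toCoord f t ∈ nonZeroDivisors (CoordRing f) ∧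
    (∀ i, evalAt (P i) s ≠ 0 ∧ evalAt (P i) t ≠ 0) ∧
    ∀ h : MvPolynomial (Fin (r + 1)) F, h.IsHomogeneous m →
      ∃ z ∈ riemannRoch G, IsFraction f z (h * t) s

/-! ### Codes -/

/-- The code `C(D, G)`, `D = P₁ + ⋯ + Pₙ`: all vectors `(z(P₁), …, z(Pₙ))` with `z ∈ L(G)`. -/
def agCode {F : Type*} [Field F] {r c n : ℕ} {f : Fin c → MvPolynomial (Fin (r + 1)) F}
    (P : Fin n → ℙ F (Fin (r + 1) → F)) (G : Divisor f) : Set (Fin n → F) :=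
  {v | ∃ z ∈ riemannRoch G, ∀ i, HasValueAt f z (P i) (v i)}

/-- The dual of a code. -/
def dualCode {F : Type*} [Field F] {n : ℕ} (C : Set (Fin n → F)) : Submodule F (Fin n → F) where
  carrier := {w | ∀ v ∈ C, ∑ i, w i * v i = 0}
  add_mem' := by
    intro a b ha hb v hv
    simp [add_mul, Finset.sum_add_distrib, ha v hv, hb v hv]
  zero_mem' := by
    intro v _
    simp
  smul_mem' := by
    intro x a ha v hv
    simp [mul_assoc, ← Finset.mul_sum, ha v hv]

/-- The minimum distance of a non-zero linear code. -/
def minDist {F : Type*} [Field F] [DecidableEq F] {n : ℕ} (C : Submodule F (Fin n → F)) : ℕ :=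
  sInf {w | ∃ x ∈ C, x ≠ 0 ∧ hammingNorm x = w}

/-- `x` is a minimum weight codeword of `C`. -/
def IsMinWeight {F : Type*} [Field F] [DecidableEq F] {n : ℕ} (C : Submodule F (Fin n → F))
    (x : Fin n → F) : Prop :=
  x ∈ C ∧ x ≠ 0 ∧ hammingNorm x = minDist C

/-! ### Plane curves in projective space -/

/-- The rational points of the curve `{Q = 0}` in the plane of `ℙ^r` parametrized by `φ`. -/
def planeCurve {F : Type*} [Field F] {r : ℕ} (φ : (Fin 3 → F) →ₗ[F] (Fin (r + 1) → F))
    (hφ : Function.Injective φ) (Q : MvPolynomial (Fin 3) F) : Set (ℙ F (Fin (r + 1) → F)) :=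
  Projectivization.map φ hφ '' {x | evalAt x Q = 0}

/-- The set `S` lies on a (possibly reducible or non-reduced) plane conic. -/
def OnPlaneConic {F : Type*} [Field F] {r : ℕ} (S : Set (ℙ F (Fin (r + 1) → F))) : Prop :=
  ∃ (φ : (Fin 3 → F) →ₗ[F] (Fin (r + 1) → F)) (hφ : Function.Injective φ)
    (Q : MvPolynomial (Fin 3) F), Q ≠ 0 ∧ Q.IsHomogeneous 2 ∧ S ⊆ planeCurve φ hφ Q

/-- The set `S` lies on the intersection of a cubic and a curve of degree `m` in a common plane,
the two curves having no common component. -/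
def OnCubicInter {F : Type*} [Field F] {r : ℕ} (S : Set (ℙ F (Fin (r + 1) → F))) (m : ℕ) : Prop :=
  ∃ (φ : (Fin 3 → F) →ₗ[F] (Fin (r + 1) → F)) (hφ : Function.Injective φ)
    (Q R : MvPolynomial (Fin 3) F), Q ≠ 0 ∧ Q.IsHomogeneous 3 ∧ R ≠ 0 ∧ R.IsHomogeneous m ∧
      IsRelPrime Q R ∧ S ⊆ planeCurve φ hφ Q ∩ planeCurve φ hφ R

end DualAGCode

end

/-! The support `S` of a word of the dual code carries a linear relation with non-zero coefficients
between the evaluations of the forms of degree `m`, because `L(G)` contains these forms. Such a set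
is called Cayley–Bacharach of degree `m` here, and the three cases are proved for every non-empty
set of this kind (`IsCayleyBacharach.trichotomy`).

Two consequences of the relation carry the argument. Multiplying the test forms by a form `Q` of
degree `k` shows that the points of `S` off `{Q = 0}` form a Cayley–Bacharach set of degree `m - k`
(`IsCayleyBacharach.residual`); as a non-empty set of degree `m` has at least `m + 2` points
(`IsCayleyBacharach.card_ge`), hypersurfaces through many points of `S` contain all of `S`.
Moreover, if `a + b = m`, then the evaluations of the forms of degrees `a` and `b` are orthogonal
for a non-degenerate bilinear form, so their ranks add up to at most the size of `S`
(`IsCayleyBacharach.finrank_add_le`).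

Removing hyperplanes shows by induction on `m` that `S` is coplanar in cases (ii) and (iii)
(`IsCayleyBacharach.inSubspace_three`), and the relation restricts to the plane. There, removing
lines and conics gives case (ii) (`IsCayleyBacharach.onCurve_two`). In case (iii) suppose that `S`
is not on a cubic. By induction on `m`, lines and conics contain few points of `S`. If `m ≤ 6`, the
ranks in degrees `3` and `m - 3` are too large. If `m ≥ 7`, then, again by induction, a cubic through
nine points of `S` contains no further point of `S`, and the remaining points lie on another cubic;
but the nine points can be chosen outside of a set of at most ten points that is not on a cubic
(`IsCayleyBacharach.onCurve_three`).

For `S` on a cubic, the ranks in degrees `m / 2` and `m - m / 2` give at least `3 * m` points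
(`IsCayleyBacharach.three_mul_le_card`), and a dimension count yields a curve of degree `m` through
`S` that does not contain the cubic. A common line or conic of the two curves is excluded by
Bézout's bound for the residual curves (`card_le_mul_of_isRelPrime`). -/

open scoped LinearAlgebra.Projectivization

noncomputable section

namespace DualAGCode

open MvPolynomial Module
open scoped Classical

variable {F : Type*} [Field F] {N : ℕ}

/-! ### Homogeneous polynomials -/

lemma finrank_homogeneousSubmodule (k : ℕ) :
    finrank F (homogeneousSubmodule (Fin 3) F k) = (k + 2).choose 2 := by
  rw [homogeneousSubmodule_eq_finsupp_supported]
  have h : {d : Fin 3 →₀ ℕ | d.degree = k} =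
      ((Finset.univ : Finset (Fin 3)).finsuppAntidiag k : Set (Fin 3 →₀ ℕ)) := by
    ext d
    simp [Finsupp.degree_eq_sum]
  rw [h]
  have e := (AddMonoidAlgebra.supportedEquivFinsupp (S := F) (R := F)
    ((Finset.univ : Finset (Fin 3)).finsuppAntidiag k : Set (Fin 3 →₀ ℕ)))
  rw [LinearEquiv.finrank_eq e, finrank_finsupp_self]
  simp only [SetLike.coe_sort_coe, Fintype.card_coe, Finset.card_finsuppAntidiag_nat_eq_choose,
    Finset.card_univ, Fintype.card_fin]
  rw [show 3 + k - 1 = k + 2 by omega, Nat.choose_symm_add]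

instance (k : ℕ) : FiniteDimensional F (homogeneousSubmodule (Fin N) F k) :=
  Module.Finite.iff_fg.2 (homogeneousSubmodule_fg (Fin N) F k)

/-- The substitution `X i ↦ X i * T`, which turns a form of degree `n` into a monomial of degree
`n` in `T`. -/
def scaleVars (N : ℕ) : MvPolynomial (Fin N) F →ₐ[F] Polynomial (MvPolynomial (Fin N) F) :=
  aeval fun i => Polynomial.C (X i) * Polynomial.X

lemma coeff_scaleVars (a : MvPolynomial (Fin N) F) (n : ℕ) :
    (scaleVars N a).coeff n = homogeneousComponent n a := by
  induction a using MvPolynomial.induction_on' with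
  | monomial d c =>
    have h1 : scaleVars N (monomial d c) =
        Polynomial.C (monomial d c) * Polynomial.X ^ d.degree := by
      rw [scaleVars, aeval_monomial, monomial_eq, Finsupp.prod_fintype _ _ (by simp),
        Finsupp.prod_fintype _ _ (by simp)]
      simp only [mul_pow, Finset.prod_mul_distrib, Finset.prod_pow_eq_pow_sum, map_mul, map_prod,
        map_pow, Finsupp.degree_eq_sum, mul_assoc]
      rfl
    have h2 : (monomial d c : MvPolynomial (Fin N) F).IsHomogeneous d.degree :=
      isHomogeneous_monomial c rfl
    rw [h1, Polynomial.coeff_C_mul_X_pow, homogeneousComponent_of_mem h2]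
  | add a b ha hb => rw [map_add, Polynomial.coeff_add, ha, hb, map_add]

lemma isHomogeneous_of_dvd {a f : MvPolynomial (Fin N) F} {n : ℕ} (hf : f.IsHomogeneous n)
    (hf0 : f ≠ 0) (h : a ∣ f) : ∃ k, a.IsHomogeneous k := by
  obtain ⟨b, rfl⟩ := h
  -- `scaleVars` is multiplicative and injective; the factors of a monomial in `T` are monomials.
  have inj : ∀ g : MvPolynomial (Fin N) F, g ≠ 0 → scaleVars N g ≠ 0 := by
    intro g hg h0
    apply hg
    rw [← sum_homogeneousComponent g]
    refine Finset.sum_eq_zero fun i _ => ?_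
    rw [← coeff_scaleVars, h0, Polynomial.coeff_zero]
  have ha := inj a (left_ne_zero_of_mul hf0)
  have hb := inj b (right_ne_zero_of_mul hf0)
  have hfm : scaleVars N (a * b) = Polynomial.monomial n (a * b) := by
    ext1 i
    rw [coeff_scaleVars, Polynomial.coeff_monomial, homogeneousComponent_of_mem hf]
    simp [eq_comm]
  have h1 := Polynomial.natDegree_mul ha hb
  have h2 := Polynomial.natTrailingDegree_mul ha hb
  rw [← map_mul, hfm, Polynomial.natDegree_monomial_eq _ hf0] at h1
  rw [← map_mul, hfm, Polynomial.natTrailingDegree_monomial hf0] at h2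
  have h3 := Polynomial.natTrailingDegree_le_natDegree (scaleVars N a)
  have h4 := Polynomial.natTrailingDegree_le_natDegree (scaleVars N b)
  refine ⟨(scaleVars N a).natDegree, ?_⟩
  rw [IsHomogeneous, IsWeightedHomogeneous]
  intro d hd
  have h5 : (scaleVars N a).coeff d.degree ≠ 0 := by
    intro h0
    rw [coeff_scaleVars] at h0
    have := congrArg (coeff d) h0
    rw [coeff_homogeneousComponent, if_pos rfl] at this
    exact hd this
  have h6 := Polynomial.le_natDegree_of_ne_zero h5
  have h7 := Polynomial.natTrailingDegree_le_of_ne_zero h5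
  have h8 : Finsupp.weight 1 d = d.degree := (Finsupp.degree_eq_weight_one (R := ℕ) ▸ rfl)
  rw [h8]
  omega

lemma exists_linearForm {W : Submodule F (Fin N → F)} {v : Fin N → F} (hv : v ∉ W) :
    ∃ l : MvPolynomial (Fin N) F, l.IsHomogeneous 1 ∧ (∀ x ∈ W, eval x l = 0) ∧ eval v l ≠ 0 := by
  obtain ⟨φ, h2, h1⟩ := Submodule.exists_le_ker_of_notMem hv
  have key : ∀ x, eval x (∑ i, C (φ (Pi.single i 1)) * X i : MvPolynomial (Fin N) F) = φ x := by
    intro x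
    conv_rhs => rw [pi_eq_sum_univ' x]
    simp [mul_comm]
  refine ⟨∑ i, C (φ (Pi.single i 1)) * X i, ?_, ?_, ?_⟩
  · exact IsHomogeneous.sum _ _ _ fun i _ => isHomogeneous_C_mul_X _ _
  · intro x hx
    rw [key]; exact h1 hx
  · rwa [key]

/-! ### Cayley–Bacharach sets -/

/-- The finite set `S` of rational points carries a linear relation, all of whose coefficients are
non-zero, between the evaluations of the forms of degree `m`. In particular every form of degree
`m` that vanishes at all points of `S` but one vanishes on `S`. The empty set qualifies. The
evaluations are taken at the chosen representatives; another choice only rescales the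
coefficients. -/
def IsCayleyBacharach (m : ℕ) (S : Finset (ℙ F (Fin N → F))) : Prop :=
  ∃ w : ℙ F (Fin N → F) → F, (∀ p ∈ S, w p ≠ 0) ∧
    ∀ h : MvPolynomial (Fin N) F, h.IsHomogeneous m → ∑ p ∈ S, w p * evalAt p h = 0

/-- The points of `S` off the hypersurface `{Q = 0}`. -/
def residualSet (Q : MvPolynomial (Fin N) F) (S : Finset (ℙ F (Fin N → F))) :
    Finset (ℙ F (Fin N → F)) :=
  S.filter fun p => evalAt p Q ≠ 0

lemma mem_residual {Q : MvPolynomial (Fin N) F} {S : Finset (ℙ F (Fin N → F))}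
    {p : ℙ F (Fin N → F)} : p ∈ residualSet Q S ↔ p ∈ S ∧ evalAt p Q ≠ 0 := by
  simp [residualSet]

/-- Multiplying the test forms by `Q` shows that removing a hypersurface of degree `k` from a
Cayley–Bacharach set lowers the degree of its relation by `k`. -/
lemma IsCayleyBacharach.residual {m k : ℕ} {S : Finset (ℙ F (Fin N → F))}
    (hS : IsCayleyBacharach (m + k) S) {Q : MvPolynomial (Fin N) F} (hQ : Q.IsHomogeneous k) :
    IsCayleyBacharach m (residualSet Q S) := by
  obtain ⟨w, hw, h⟩ := hS
  refine ⟨fun p => w p * evalAt p Q, ?_, ?_⟩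
  · intro p hp
    rw [mem_residual] at hp
    exact mul_ne_zero (hw p hp.1) hp.2
  · intro g hg
    have := h (g * Q) (hg.mul hQ)
    rw [residualSet, Finset.sum_filter_of_ne]
    · rw [← this]
      refine Finset.sum_congr rfl fun p _ => ?_
      simp only [evalAt, map_mul]; ring
    · intro p _ h1 h2
      simp [h2] at h1

/-- A Cayley–Bacharach set remains one, of degree one less, after the removal of a suitable
hyperplane that contains a given subspace `W` and misses a given point outside of `W`. -/
lemma IsCayleyBacharach.exists_off {m : ℕ} {S : Finset (ℙ F (Fin N → F))}
    (hS : IsCayleyBacharach (m + 1) S) {W : Submodule F (Fin N → F)} {p : ℙ F (Fin N → F)}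
    (hp : p ∈ S) (hpW : p.rep ∉ W) :
    ∃ R ⊆ S, p ∈ R ∧ IsCayleyBacharach m R ∧ ∀ q ∈ R, q.rep ∉ W := by
  obtain ⟨l, hl, h1, h2⟩ := exists_linearForm hpW
  refine ⟨residualSet l S, Finset.filter_subset _ _, mem_residual.2 ⟨hp, h2⟩,
    hS.residual hl, ?_⟩
  intro q hq hqW
  exact (mem_residual.1 hq).2 (h1 _ hqW)

lemma rep_notMem_span_singleton {p q : ℙ F (Fin N → F)} (h : p ≠ q) :
    p.rep ∉ Submodule.span F {q.rep} := by
  intro hp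
  obtain ⟨a, ha⟩ := Submodule.mem_span_singleton.1 hp
  apply h
  rw [← p.mk_rep, ← q.mk_rep, Projectivization.mk_eq_mk_iff']
  exact ⟨a, ha⟩

lemma IsCayleyBacharach.card_ge {m : ℕ} {S : Finset (ℙ F (Fin N → F))}
    (hS : IsCayleyBacharach m S) (hne : S.Nonempty) : m + 2 ≤ S.card := by
  have single : ∀ (m : ℕ) (p : ℙ F (Fin N → F)), ¬ IsCayleyBacharach m {p} := by
    rintro m p ⟨w, hw, h⟩
    obtain ⟨l, hl, -, h2⟩ := exists_linearForm (W := (⊥ : Submodule F (Fin N → F))) (v := p.rep)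
      (by simpa using p.rep_nonzero)
    have := h (l ^ m) (by simpa using hl.pow m)
    simp only [Finset.sum_singleton, evalAt, map_pow, mul_eq_zero] at this
    rcases this with h3 | h3
    · exact hw p (by simp) h3
    · exact pow_ne_zero m h2 h3
  induction m generalizing S with
  | zero =>
    by_contra hlt
    have : S.card = 1 := by have := hne.card_pos; omega
    obtain ⟨p, rfl⟩ := Finset.card_eq_one.1 this
    exact single _ _ hS
  | succ m ih =>
    obtain ⟨p, hp⟩ := hne
    by_cases hq : ∃ q ∈ S, q ≠ p
    · obtain ⟨q, hq, hqp⟩ := hq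
      obtain ⟨R, hRS, hqR, hR, hRW⟩ := hS.exists_off hq (rep_notMem_span_singleton hqp)
      have h1 := ih hR ⟨q, hqR⟩
      have h2 : p ∉ R := fun h => hRW p h (Submodule.mem_span_singleton_self _)
      have h3 : R.card < S.card := Finset.card_lt_card ⟨hRS, fun h => h2 (h hp)⟩
      omega
    · push Not at hq
      have : S = {p} := Finset.eq_singleton_iff_unique_mem.2 ⟨hp, hq⟩
      subst this
      exact (single _ _ hS).elim

/-! ### Evaluation of forms on a finite set of points -/

/-- Evaluation of the forms of degree `k` at the points of `S`. -/
def evalForms (k : ℕ) (S : Finset (ℙ F (Fin N → F))) :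
    homogeneousSubmodule (Fin N) F k →ₗ[F] (S → F) where
  toFun h p := evalAt p.1 h.1
  map_add' := by intros; ext; simp [evalAt]
  map_smul' := by intros; ext; simp [evalAt, smul_eval]

@[simp] lemma evalForms_apply (k : ℕ) (S : Finset (ℙ F (Fin N → F)))
    (h : homogeneousSubmodule (Fin N) F k) (p : S) : evalForms k S h p = evalAt p.1 h.1 := rfl

lemma evalForms_surjective {k : ℕ} {S : Finset (ℙ F (Fin N → F))} (hk : S.card ≤ k + 1) :
    LinearMap.range (evalForms k S) = ⊤ := by
  by_contra hne
  obtain ⟨φ, hφ0, hφ⟩ := Submodule.exists_le_ker_of_lt_top _ (lt_top_iff_ne_top.2 hne)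
  set w : ℙ F (Fin N → F) → F := fun p => if hp : p ∈ S then φ (Pi.single ⟨p, hp⟩ 1) else 0
    with hw
  have hφw : ∀ x : S → F, φ x = ∑ p : S, w p.1 * x p := by
    intro x
    conv_lhs => rw [← Finset.univ_sum_single x]
    rw [map_sum]
    refine Finset.sum_congr rfl fun p _ => ?_
    have : (Pi.single p (x p) : S → F) = x p • Pi.single p 1 := by
      rw [← Pi.single_smul]; simp
    rw [this, map_smul]
    simp [hw, mul_comm]
  have hCB : IsCayleyBacharach k (S.filter fun p => w p ≠ 0) := by
    refine ⟨w, fun p hp => (Finset.mem_filter.1 hp).2, fun h hh => ?_⟩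
    rw [Finset.sum_filter_of_ne]
    · have h1 : φ (evalForms k S ⟨h, hh⟩) = 0 := hφ ⟨_, rfl⟩
      rw [hφw] at h1
      rw [← Finset.sum_coe_sort S]
      exact h1
    · intro p _ h1 h2
      simp [h2] at h1
  have hne' : (S.filter fun p => w p ≠ 0).Nonempty := by
    rw [Finset.nonempty_iff_ne_empty]
    intro he
    apply hφ0
    ext x
    simp only [LinearMap.comp_apply, hφw, LinearMap.zero_apply]
    refine Finset.sum_eq_zero fun p _ => ?_
    have : w p.1 = 0 := by
      by_contra h
      have : p.1 ∈ S.filter fun p => w p ≠ 0 := Finset.mem_filter.2 ⟨p.2, h⟩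
      simp [he] at this
    rw [this, zero_mul]
  have h1 := hCB.card_ge hne'
  have h2 := Finset.card_filter_le S fun p => w p ≠ 0
  omega

/-- The relation of a Cayley–Bacharach set makes the images of the forms of complementary degrees
`a` and `b` orthogonal for a non-degenerate form. -/
lemma IsCayleyBacharach.finrank_add_le {a b : ℕ} {S : Finset (ℙ F (Fin N → F))}
    (hS : IsCayleyBacharach (a + b) S) :
    finrank F (LinearMap.range (evalForms a S)) + finrank F (LinearMap.range (evalForms b S)) ≤
      S.card := by
  obtain ⟨w, hw, h⟩ := hS
  let Φ : (S → F) →ₗ[F] Dual F (S → F) :=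
    LinearMap.mk₂ F (fun x y => ∑ p : S, w p.1 * (x p * y p))
      (by intros; simp only [Pi.add_apply, add_mul, mul_add, Finset.sum_add_distrib])
      (by
        intros
        simp only [Pi.smul_apply, smul_eq_mul, Finset.mul_sum]
        exact Finset.sum_congr rfl fun _ _ => by ring)
      (by intros; simp only [Pi.add_apply, mul_add, Finset.sum_add_distrib])
      (by
        intros
        simp only [Pi.smul_apply, smul_eq_mul, Finset.mul_sum]
        exact Finset.sum_congr rfl fun _ _ => by ring)
  have hΦ_apply : ∀ x y, Φ x y = ∑ p : S, w p.1 * (x p * y p) := fun _ _ => rfl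
  have hΦ : Function.Injective Φ := by
    rw [← LinearMap.ker_eq_bot, LinearMap.ker_eq_bot']
    intro x hx
    ext p
    have := LinearMap.congr_fun hx (Pi.single p 1)
    rw [hΦ_apply, LinearMap.zero_apply, Finset.sum_eq_single p] at this
    · simpa [hw p.1 p.2] using this
    · intro q _ hq; simp [hq]
    · simp
  have hle : (LinearMap.range (evalForms a S)).map Φ ≤
      (LinearMap.range (evalForms b S)).dualAnnihilator := by
    rintro _ ⟨_, ⟨f, rfl⟩, rfl⟩
    rw [Submodule.mem_dualAnnihilator]
    rintro _ ⟨g, rfl⟩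
    have := h (f.1 * g.1) (IsHomogeneous.mul f.2 g.2)
    rw [← Finset.sum_coe_sort] at this
    rw [← this, hΦ_apply]
    simp [evalAt]
  have h1 := Submodule.finrank_mono hle
  rw [← LinearEquiv.finrank_eq (Submodule.equivMapOfInjective Φ hΦ _)] at h1
  have h2 := Subspace.finrank_add_finrank_dualAnnihilator_eq (LinearMap.range (evalForms b S))
  simp at h2
  omega

/-! ### Plane curves through finite sets of points -/

/-- The points of `T` lie on a plane curve of degree `k`, possibly reducible or non-reduced. -/
def OnCurve (k : ℕ) (T : Finset (ℙ F (Fin 3 → F))) : Prop :=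
  ∃ Q : MvPolynomial (Fin 3) F, Q ≠ 0 ∧ Q.IsHomogeneous k ∧ ∀ p ∈ T, evalAt p Q = 0

/-- A plane curve of degree `k` contains at most `b` points of `S`. -/
def CurveBound (k b : ℕ) (S : Finset (ℙ F (Fin 3 → F))) : Prop :=
  ∀ T ⊆ S, OnCurve k T → T.card ≤ b

lemma OnCurve.mono {k : ℕ} {S T : Finset (ℙ F (Fin 3 → F))} (h : OnCurve k S) (hT : T ⊆ S) :
    OnCurve k T :=
  h.imp fun _ hQ => ⟨hQ.1, hQ.2.1, fun p hp => hQ.2.2 p (hT hp)⟩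

lemma CurveBound.mono {k b : ℕ} {S T : Finset (ℙ F (Fin 3 → F))} (h : CurveBound k b S)
    (hT : T ⊆ S) : CurveBound k b T :=
  fun U hU => h U (hU.trans hT)

lemma residual_subset {N : ℕ} (Q : MvPolynomial (Fin N) F) (S : Finset (ℙ F (Fin N → F))) :
    residualSet Q S ⊆ S := Finset.filter_subset _ _

lemma onCurve_of_card_lt {k : ℕ} {S : Finset (ℙ F (Fin 3 → F))} (h : S.card < (k + 2).choose 2) :
    OnCurve k S := by
  have h1 : LinearMap.ker (evalForms k S) ≠ ⊥ := by
    apply LinearMap.ker_ne_bot_of_finrank_lt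
    rw [finrank_homogeneousSubmodule]
    simpa using h
  obtain ⟨Q, hQ, hQ0⟩ := Submodule.exists_mem_ne_zero_of_ne_bot h1
  refine ⟨Q.1, fun h0 => hQ0 (Subtype.ext h0), Q.2, fun p hp => ?_⟩
  exact congrFun (LinearMap.mem_ker.1 hQ) ⟨p, hp⟩

lemma OnCurve.of_residual {a b : ℕ} {S : Finset (ℙ F (Fin 3 → F))} {Q : MvPolynomial (Fin 3) F}
    (hQ0 : Q ≠ 0) (hQ : Q.IsHomogeneous a) (h : OnCurve b (residualSet Q S)) : OnCurve (a + b) S := by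
  obtain ⟨R, hR0, hR, hv⟩ := h
  refine ⟨Q * R, mul_ne_zero hQ0 hR0, hQ.mul hR, fun p hp => ?_⟩
  rw [evalAt, map_mul]
  by_cases h : evalAt p Q = 0
  · exact mul_eq_zero_of_left h _
  · exact mul_eq_zero_of_right _ (hv p (mem_residual.2 ⟨hp, h⟩))

lemma residual_nonempty {k : ℕ} {S : Finset (ℙ F (Fin 3 → F))} {Q : MvPolynomial (Fin 3) F}
    (hQ0 : Q ≠ 0) (hQ : Q.IsHomogeneous k) (h : ¬ OnCurve k S) : (residualSet Q S).Nonempty := by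
  rw [Finset.nonempty_iff_ne_empty]
  intro he
  refine h ⟨Q, hQ0, hQ, fun p hp => ?_⟩
  by_contra h0
  have : p ∈ residualSet Q S := mem_residual.2 ⟨hp, h0⟩
  simp [he] at this

lemma card_residual_add_le {T S : Finset (ℙ F (Fin 3 → F))} (hT : T ⊆ S)
    {Q : MvPolynomial (Fin 3) F} (h : ∀ p ∈ T, evalAt p Q = 0) :
    (residualSet Q S).card + T.card ≤ S.card := by
  rw [← Finset.card_union_of_disjoint]
  · exact Finset.card_le_card (Finset.union_subset (residual_subset _ _) hT)
  · rw [Finset.disjoint_left]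
    exact fun p hp hpT => (mem_residual.1 hp).2 (h p hpT)

lemma CurveBound.card_le {k b : ℕ} {S : Finset (ℙ F (Fin 3 → F))} (h : CurveBound k b S)
    {Q : MvPolynomial (Fin 3) F} (hQ0 : Q ≠ 0) (hQ : Q.IsHomogeneous k) :
    S.card ≤ b + (residualSet Q S).card := by
  have h1 := h (S.filter fun p => evalAt p Q = 0) (Finset.filter_subset _ _)
    ⟨Q, hQ0, hQ, fun p hp => (Finset.mem_filter.1 hp).2⟩
  have h2 := S.card_filter_add_card_filter_not fun p => evalAt p Q = 0
  simp only [residualSet, ne_eq]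
  omega

/-! ### Common factors and Bézout's bound -/

/-- Forms of degree `k` divisible by a fixed form of degree `a` are the multiples by the forms of
degree `k - a`. -/
lemma exists_eq_mul_of_dvd {N a k : ℕ} {Q R : MvPolynomial (Fin N) F} (hQ : Q.IsHomogeneous a)
    (hR : R.IsHomogeneous k) (hR0 : R ≠ 0) (h : Q ∣ R) :
    ∃ A : MvPolynomial (Fin N) F, R = Q * A ∧ a ≤ k ∧ A.IsHomogeneous (k - a) := by
  obtain ⟨A, rfl⟩ := h
  obtain ⟨j, hj⟩ := isHomogeneous_of_dvd hR hR0 (Dvd.intro_left Q rfl)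
  have := (hQ.mul hj).inj_right hR hR0
  refine ⟨A, rfl, by omega, ?_⟩
  rwa [← this, Nat.add_sub_cancel_left]

lemma finrank_le_of_forall_dvd {k : ℕ} {Q : MvPolynomial (Fin 3) F} (hQ : Q.IsHomogeneous 3)
    (K : Submodule F (homogeneousSubmodule (Fin 3) F k)) (hK : ∀ R ∈ K, Q ∣ R.1) :
    finrank F K ≤ (k - 1).choose 2 := by
  by_cases hk : 3 ≤ k
  · have hle : K.map (Submodule.subtype _) ≤
        (homogeneousSubmodule (Fin 3) F (k - 3)).map (LinearMap.mulLeft F Q) := by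
      rintro _ ⟨R, hR, rfl⟩
      by_cases h0 : R.1 = 0
      · simp only [Submodule.subtype_apply, h0]; exact zero_mem _
      · obtain ⟨A, hA, -, hAh⟩ := exists_eq_mul_of_dvd hQ R.2 h0 (hK R hR)
        exact ⟨A, hAh, hA.symm⟩
    have h1 := Submodule.finrank_mono hle
    rw [← LinearEquiv.finrank_eq (Submodule.equivMapOfInjective _ (Submodule.subtype_injective _) _)]
      at h1
    have h2 := Submodule.finrank_map_le (LinearMap.mulLeft F Q)
      (homogeneousSubmodule (Fin 3) F (k - 3))
    rw [finrank_homogeneousSubmodule, show k - 3 + 2 = k - 1 by omega] at h2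
    exact h1.trans h2
  · have : K = ⊥ := by
      rw [eq_bot_iff]
      intro R hR
      by_contra h0
      obtain ⟨A, -, h1, -⟩ := exists_eq_mul_of_dvd hQ R.2 (fun h => h0 (Subtype.ext h)) (hK R hR)
      exact hk h1
    rw [this, finrank_bot]
    exact Nat.zero_le _

lemma finrank_ker_add_finrank_range (k : ℕ) (S : Finset (ℙ F (Fin 3 → F))) :
    finrank F (LinearMap.ker (evalForms k S)) + finrank F (LinearMap.range (evalForms k S)) =
      (k + 2).choose 2 := by
  rw [add_comm, LinearMap.finrank_range_add_finrank_ker, finrank_homogeneousSubmodule]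

lemma choose_identity (a b t : ℕ) :
    (a + b + t + 2).choose 2 + (t + 2).choose 2 =
      (b + t + 2).choose 2 + (a + t + 2).choose 2 + a * b := by
  have h : ∀ n : ℕ, ((n + 2).choose 2 : ℚ) = (n + 2) * (n + 1) / 2 := by
    intro n
    rw [Nat.cast_choose_two]; push_cast; ring
  have : ((a + b + t + 2).choose 2 + (t + 2).choose 2 : ℚ) =
      (b + t + 2).choose 2 + (a + t + 2).choose 2 + a * b := by
    rw [h, h, h, h]; push_cast; ring
  exact_mod_cast this

/-- Bézout's bound for the rational points common to two plane curves without common component. In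
a large degree `k` the ideal `(Q, R)` has codimension `a * b`, because all relations between `Q` and
`R` are multiples of the obvious one, while the points of `Z` impose independent conditions. -/
theorem card_le_mul_of_isRelPrime {a b : ℕ} {Q R : MvPolynomial (Fin 3) F} (hQ : Q.IsHomogeneous a)
    (hR : R.IsHomogeneous b) (hR0 : R ≠ 0) (hQR : IsRelPrime Q R)
    {Z : Finset (ℙ F (Fin 3 → F))} (hZQ : ∀ p ∈ Z, evalAt p Q = 0)
    (hZR : ∀ p ∈ Z, evalAt p R = 0) : Z.card ≤ a * b := by
  set t := Z.card with ht
  let V := homogeneousSubmodule (Fin 3) F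
  let Φ : (V (b + t) × V (a + t)) →ₗ[F] MvPolynomial (Fin 3) F :=
    LinearMap.coprod ((LinearMap.mulLeft F Q).comp (V (b + t)).subtype)
      ((LinearMap.mulLeft F R).comp (V (a + t)).subtype)
  have hΦ : ∀ A B, Φ (A, B) = Q * A.1 + R * B.1 := fun A B => by simp [Φ]
  have hrange : LinearMap.range Φ ≤
      (LinearMap.ker (evalForms (a + b + t) Z)).map (V (a + b + t)).subtype := by
    rintro _ ⟨⟨A, B⟩, rfl⟩
    have h1 : (Q * A.1 + R * B.1).IsHomogeneous (a + b + t) := by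
      refine IsHomogeneous.add ?_ ?_
      · have := hQ.mul A.2; rwa [← add_assoc] at this
      · have := hR.mul B.2; rwa [← add_assoc, add_comm b a] at this
    refine ⟨⟨_, h1⟩, ?_, (hΦ A B).symm⟩
    change evalForms _ _ _ = 0
    ext p
    have e1 := hZQ p.1 p.2
    have e2 := hZR p.1 p.2
    simp only [evalAt] at e1 e2
    simp [evalAt, e1, e2]
  have hker : finrank F (LinearMap.ker Φ) ≤ (t + 2).choose 2 := by
    let Ψ : V t →ₗ[F] (MvPolynomial (Fin 3) F × MvPolynomial (Fin 3) F) :=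
      LinearMap.prod ((LinearMap.mulLeft F R).comp (V t).subtype)
        (-(LinearMap.mulLeft F Q).comp (V t).subtype)
    have hle : (LinearMap.ker Φ).map (LinearMap.prodMap (V (b + t)).subtype (V (a + t)).subtype) ≤
        LinearMap.range Ψ := by
      rintro _ ⟨⟨A, B⟩, hAB, rfl⟩
      have h1 : Q * A.1 + R * B.1 = 0 := by rw [← hΦ]; exact hAB
      have h2 : R ∣ A.1 := by
        have : R ∣ Q * A.1 := ⟨-B.1, by linear_combination h1⟩
        exact hQR.symm.dvd_of_dvd_mul_left this
      have h3 : ∃ C : V t, A.1 = R * C.1 := by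
        by_cases h0 : A.1 = 0
        · exact ⟨0, by simp [h0]⟩
        · obtain ⟨C, hC, -, hCh⟩ := exists_eq_mul_of_dvd hR A.2 h0 h2
          exact ⟨⟨C, by rwa [Nat.add_sub_cancel_left] at hCh⟩, hC⟩
      obtain ⟨C, hC⟩ := h3
      refine ⟨C, ?_⟩
      have h4 : B.1 = -(Q * C.1) := by
        apply mul_left_cancel₀ hR0
        rw [hC] at h1
        linear_combination h1
      ext1
      · simp [Ψ, hC]
      · simp [Ψ, h4]
    have hinj : Function.Injective
        (LinearMap.prodMap (V (b + t)).subtype (V (a + t)).subtype) :=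
      Function.Injective.prodMap (Submodule.subtype_injective _) (Submodule.subtype_injective _)
    have h1 := Submodule.finrank_mono hle
    rw [← LinearEquiv.finrank_eq (Submodule.equivMapOfInjective _ hinj _)] at h1
    have h2 := LinearMap.finrank_range_le Ψ
    rw [finrank_homogeneousSubmodule] at h2
    exact h1.trans h2
  have h1 := LinearMap.finrank_range_add_finrank_ker Φ
  rw [finrank_prod, finrank_homogeneousSubmodule, finrank_homogeneousSubmodule] at h1
  have h2 : finrank F (LinearMap.range Φ) ≤
      finrank F (LinearMap.ker (evalForms (a + b + t) Z)) := by
    rw [LinearEquiv.finrank_eq (Submodule.equivMapOfInjective _ (Submodule.subtype_injective _)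
      (LinearMap.ker (evalForms (a + b + t) Z)))]
    exact Submodule.finrank_mono hrange
  have h3 := finrank_ker_add_finrank_range (a + b + t) Z
  rw [evalForms_surjective (by omega), finrank_top] at h3
  simp only [finrank_fintype_fun_eq_card, Fintype.card_coe] at h3
  have h4 := choose_identity a b t
  omega

/-- A curve of degree `k` through the points of `S` on a cubic that does not contain the cubic
either meets the cubic properly, or all but few points of `S` lie on a common line or conic. -/
lemma cubic_inter {k : ℕ} {Q R : MvPolynomial (Fin 3) F} (hQ : Q.IsHomogeneous 3)
    (hR : R.IsHomogeneous k) (hQ0 : Q ≠ 0) (hQR : ¬ Q ∣ R)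
    {S : Finset (ℙ F (Fin 3 → F))} (hSQ : ∀ p ∈ S, evalAt p Q = 0)
    (hSR : ∀ p ∈ S, evalAt p R = 0) :
    (IsRelPrime Q R ∧ S.card ≤ 3 * k) ∨
    (∃ g : MvPolynomial (Fin 3) F, g ≠ 0 ∧ g.IsHomogeneous 1 ∧
      1 ≤ k ∧ (residualSet g S).card ≤ 2 * (k - 1)) ∨
    (∃ g : MvPolynomial (Fin 3) F, g ≠ 0 ∧ g.IsHomogeneous 2 ∧
      2 ≤ k ∧ (residualSet g S).card ≤ k - 2) := by
  have hR0 : R ≠ 0 := by rintro rfl; exact hQR (dvd_zero _)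
  obtain ⟨Q', R', g, hrel, hQ', hR'⟩ := UniqueFactorizationMonoid.exists_reduced_factors Q hQ0 R
  have hg0 : g ≠ 0 := by rintro rfl; simp at hQ'; exact hQ0 hQ'.symm
  have hQ'0 : Q' ≠ 0 := by rintro rfl; simp at hQ'; exact hQ0 hQ'.symm
  have hR'0 : R' ≠ 0 := by rintro rfl; simp at hR'; exact hR0 hR'.symm
  obtain ⟨γ, hg⟩ := isHomogeneous_of_dvd hQ hQ0 (Dvd.intro _ hQ')
  obtain ⟨a, hQh⟩ := isHomogeneous_of_dvd hQ hQ0 (Dvd.intro_left _ hQ')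
  obtain ⟨b, hRh⟩ := isHomogeneous_of_dvd hR hR0 (Dvd.intro_left _ hR')
  have ha : γ + a = 3 := (hg.mul hQh).inj_right (hQ'.symm ▸ hQ) (hQ'.symm ▸ hQ0)
  have hb : γ + b = k := (hg.mul hRh).inj_right (hR'.symm ▸ hR) (hR'.symm ▸ hR0)
  have key : (residualSet g S).card ≤ a * b := by
    refine card_le_mul_of_isRelPrime hQh hRh hR'0 hrel ?_ ?_
    · intro p hp
      obtain ⟨h1, h2⟩ := mem_residual.1 hp
      have h3 := hSQ p h1
      rw [← hQ', evalAt, map_mul] at h3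
      exact (mul_eq_zero.1 h3).resolve_left h2
    · intro p hp
      obtain ⟨h1, h2⟩ := mem_residual.1 hp
      have h3 := hSR p h1
      rw [← hR', evalAt, map_mul] at h3
      exact (mul_eq_zero.1 h3).resolve_left h2
  have unit_of : ∀ q : MvPolynomial (Fin 3) F, q ≠ 0 → q.IsHomogeneous 0 → IsUnit q := by
    intro q hq hq0
    have h1 := totalDegree_eq_zero_iff_eq_C.1 ((totalDegree_zero_iff_isHomogeneous _).2 hq0)
    rw [h1]
    refine (IsUnit.mk0 _ fun h => hq ?_).map C
    rw [h1, h, map_zero]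
  have hγ : γ = 0 ∨ γ = 1 ∨ γ = 2 ∨ γ = 3 := by omega
  rcases hγ with rfl | rfl | rfl | rfl
  · left
    have hu := unit_of g hg0 hg
    have h1 : IsRelPrime Q R := by
      rw [← hQ', ← hR']
      exact (isRelPrime_mul_unit_left_left hu).2 ((isRelPrime_mul_unit_left_right hu).2 hrel)
    refine ⟨h1, card_le_mul_of_isRelPrime hQ hR hR0 h1 hSQ hSR⟩
  · right; left
    obtain rfl : a = 2 := by omega
    obtain rfl : b = k - 1 := by omega
    exact ⟨g, hg0, hg, by omega, key⟩
  · right; right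
    obtain rfl : a = 1 := by omega
    obtain rfl : b = k - 2 := by omega
    exact ⟨g, hg0, hg, by omega, by omega⟩
  · obtain rfl : a = 0 := by omega
    exact (hQR (by
      rw [← hQ', ← hR']
      exact mul_dvd_mul_left g ((unit_of Q' hQ'0 hQh).dvd))).elim

/-! ### Cayley–Bacharach sets in the plane -/

lemma IsCayleyBacharach.residual_sub {N m k : ℕ} {S : Finset (ℙ F (Fin N → F))}
    (hS : IsCayleyBacharach m S) {Q : MvPolynomial (Fin N) F} (hQ : Q.IsHomogeneous k)
    (hk : k ≤ m) : IsCayleyBacharach (m - k) (residualSet Q S) := by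
  obtain ⟨j, rfl⟩ := Nat.exists_eq_add_of_le' hk
  rw [Nat.add_sub_cancel]
  exact hS.residual hQ

lemma OnCurve.of_residual_eq_empty {k : ℕ} {S : Finset (ℙ F (Fin 3 → F))}
    {Q : MvPolynomial (Fin 3) F} (hQ0 : Q ≠ 0) (hQ : Q.IsHomogeneous k)
    (h : ¬ (residualSet Q S).Nonempty) : OnCurve k S := by
  by_contra hS
  exact h (residual_nonempty hQ0 hQ hS)

/-- A Cayley–Bacharach set of the least possible size lies on a line: otherwise a line through two
of its points leaves a residual set that is too small. -/
lemma IsCayleyBacharach.onCurve_one {m : ℕ} {S : Finset (ℙ F (Fin 3 → F))}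
    (hS : IsCayleyBacharach m S) (hc : S.card ≤ m + 2) : OnCurve 1 S := by
  by_cases h2 : S.card ≤ 2
  · exact onCurve_of_card_lt (by norm_num [Nat.choose]; omega)
  obtain ⟨T, hTS, hT⟩ := Finset.exists_subset_card_eq (show 2 ≤ S.card by omega)
  obtain ⟨L, hL0, hL, hLT⟩ : OnCurve 1 T := onCurve_of_card_lt (by norm_num [Nat.choose]; omega)
  refine OnCurve.of_residual_eq_empty hL0 hL fun hne => ?_
  have h3 := (hS.residual_sub hL (by omega)).card_ge hne
  have h4 := card_residual_add_le hTS hLT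
  omega

/-- A Cayley–Bacharach set of at most `2 * m + 2` points without `m + 2` collinear ones has exactly
`2 * m + 2` points and lies on a conic. -/
theorem IsCayleyBacharach.onCurve_two {m : ℕ} {S : Finset (ℙ F (Fin 3 → F))}
    (hS : IsCayleyBacharach m S) (hne : S.Nonempty) (hc : S.card ≤ 2 * m + 2)
    (hl : CurveBound 1 (m + 1) S) : S.card = 2 * m + 2 ∧ OnCurve 2 S := by
  induction m using Nat.strong_induction_on generalizing S with
  | _ m ih =>
  have hge := hS.card_ge hne
  have hn1 : ¬ OnCurve 1 S := fun h => by have := hl S subset_rfl h; omega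
  have hm : 1 ≤ m := by
    by_contra h0
    exact hn1 (onCurve_of_card_lt (by norm_num [Nat.choose]; omega))
  by_cases hbig : ∃ T ⊆ S, OnCurve 1 T ∧ m + 1 ≤ T.card
  · obtain ⟨T, hTS, ⟨L, hL0, hL, hLT⟩, hT⟩ := hbig
    have hR := hS.residual_sub hL hm
    have h1 := hR.card_ge (residual_nonempty hL0 hL hn1)
    have h2 := card_residual_add_le hTS hLT
    exact ⟨by omega, OnCurve.of_residual hL0 hL (hR.onCurve_one (by omega))⟩
  push Not at hbig
  -- The residual set of a line through at least two points satisfies the induction hypothesis, so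
  -- every line contains at most two points.
  have hline : ∀ T ⊆ S, OnCurve 1 T → 2 ≤ T.card → T.card = 2 ∧ S.card = 2 * m + 2 := by
    rintro T hTS ⟨L, hL0, hL, hLT⟩ hT
    have h2 := card_residual_add_le hTS hLT
    have h1 := (ih (m - 1) (by omega) (hS.residual_sub hL hm) (residual_nonempty hL0 hL hn1)
      (by omega) fun U hU hU1 => by
        have := hbig U (hU.trans (residual_subset _ _)) hU1; omega).1
    omega
  have hcard : S.card = 2 * m + 2 := by
    obtain ⟨T, hTS, hT⟩ := Finset.exists_subset_card_eq (show 2 ≤ S.card by omega)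
    exact (hline T hTS (onCurve_of_card_lt (by norm_num [Nat.choose]; omega)) hT.ge).2
  refine ⟨hcard, ?_⟩
  by_cases hm1 : m = 1
  · exact onCurve_of_card_lt (by norm_num [Nat.choose]; omega)
  obtain ⟨T, hTS, hT⟩ := Finset.exists_subset_card_eq (show 5 ≤ S.card by omega)
  obtain ⟨Q, hQ0, hQ, hQT⟩ : OnCurve 2 T := onCurve_of_card_lt (by norm_num [Nat.choose]; omega)
  refine OnCurve.of_residual_eq_empty hQ0 hQ fun hne' => ?_
  have h1 := card_residual_add_le hTS hQT
  have h2 := (ih (m - 2) (by omega) (hS.residual_sub hQ (by omega)) hne' (by omega)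
    fun U hU hU1 => by
      have h3 := Finset.card_le_card hU
      by_cases hU2 : 2 ≤ U.card
      · have := (hline U (hU.trans (residual_subset _ _)) hU1 hU2).1
        omega
      · omega).1
  omega

lemma IsCayleyBacharach.lt_card {m : ℕ} {S : Finset (ℙ F (Fin 3 → F))}
    (hS : IsCayleyBacharach m S) (hne : S.Nonempty) (hl : CurveBound 1 (m + 1) S)
    (hq : CurveBound 2 (2 * m + 1) S) : 2 * m + 2 < S.card := by
  by_contra h
  obtain ⟨h1, h2⟩ := hS.onCurve_two hne (by omega) hl
  have := hq S subset_rfl h2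
  omega

lemma choose_two_identity {k : ℕ} (hk : 1 ≤ k) :
    (k + 2).choose 2 = (k - 1).choose 2 + 3 * k := by
  obtain ⟨j, rfl⟩ := Nat.exists_eq_add_of_le' hk
  have : ((j + 1 + 2).choose 2 : ℚ) = (j.choose 2 + 3 * (j + 1) : ℕ) := by
    rw [Nat.cast_choose_two]
    push_cast [Nat.cast_choose_two]
    ring
  exact_mod_cast this

lemma le_finrank_range_of_dvd {k : ℕ} (hk : 1 ≤ k) {Q : MvPolynomial (Fin 3) F}
    (hQ : Q.IsHomogeneous 3) {S : Finset (ℙ F (Fin 3 → F))}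
    (h : ∀ R : MvPolynomial (Fin 3) F, R.IsHomogeneous k → (∀ p ∈ S, evalAt p R = 0) → Q ∣ R) :
    3 * k ≤ finrank F (LinearMap.range (evalForms k S)) := by
  have h1 := finrank_le_of_forall_dvd hQ (LinearMap.ker (evalForms k S)) fun R hR =>
    h R.1 R.2 fun p hp => congrFun (LinearMap.mem_ker.1 hR) ⟨p, hp⟩
  have h2 := finrank_ker_add_finrank_range k S
  have h3 := choose_two_identity hk
  omega

/-- If `S` lies on a cubic `Q` then the curves of degree about `m / 2` through `S` contain `Q`, so
the forms of the two degrees `m / 2` and `m - m / 2` together impose `3 * m` conditions; these are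
orthogonal by the Cayley–Bacharach relation. -/
lemma IsCayleyBacharach.three_mul_le_card {m : ℕ} {S : Finset (ℙ F (Fin 3 → F))}
    (hS : IsCayleyBacharach m S) (hm : 2 ≤ m) (hl : CurveBound 1 (m + 1) S)
    (hq : CurveBound 2 (2 * m + 1) S) (hgt : 2 * m + 2 < S.card) (h3 : OnCurve 3 S) :
    3 * m ≤ S.card := by
  obtain ⟨Q, hQ0, hQ, hQS⟩ := h3
  have key : ∀ k, 1 ≤ k → 2 * k ≤ m + 1 →
      3 * k ≤ finrank F (LinearMap.range (evalForms k S)) := by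
    intro k hk hkm
    refine le_finrank_range_of_dvd hk hQ fun R hR hRS => ?_
    by_contra hQR
    rcases cubic_inter hQ hR hQ0 hQR hQS hRS with ⟨-, h⟩ | ⟨g, hg0, hg, -, h⟩ | ⟨g, hg0, hg, -, h⟩
    · omega
    · have := hl.card_le hg0 hg
      omega
    · have h4 := hq.card_le hg0 hg
      have h5 := (hS.residual_sub hg hm).card_ge (Finset.card_pos.1 (by omega))
      omega
  have h1 := key (m / 2) (by omega) (by omega)
  have h2 := key (m - m / 2) (by omega) (by omega)
  have h4 : IsCayleyBacharach (m / 2 + (m - m / 2)) S := by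
    rwa [Nat.add_sub_cancel' (Nat.div_le_self m 2)]
  have := h4.finrank_add_le
  omega

lemma finrank_range_of_not_onCurve {k : ℕ} {S : Finset (ℙ F (Fin 3 → F))} (h : ¬ OnCurve k S) :
    finrank F (LinearMap.range (evalForms k S)) = (k + 2).choose 2 := by
  have h1 : LinearMap.ker (evalForms k S) = ⊥ := by
    rw [eq_bot_iff]
    intro Q hQ
    by_contra h0
    exact h ⟨Q.1, fun h1 => h0 (Subtype.ext h1), Q.2,
      fun p hp => congrFun (LinearMap.mem_ker.1 hQ) ⟨p, hp⟩⟩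
  have h2 := finrank_ker_add_finrank_range k S
  rwa [h1, finrank_bot, zero_add] at h2

/-- A set not contained in a curve of degree `k` has a subset with the same property whose size is
at most the dimension of the space of forms of degree `k`: for a minimal such subset the curves
through all but one of its points give linearly independent forms. -/
lemma exists_subset_not_onCurve {k : ℕ} {S : Finset (ℙ F (Fin 3 → F))} (h : ¬ OnCurve k S) :
    ∃ A ⊆ S, ¬ OnCurve k A ∧ A.card ≤ (k + 2).choose 2 := by
  obtain ⟨A, hA, hmin⟩ := Finset.exists_min_image (S.powerset.filter fun A => ¬ OnCurve k A)
    Finset.card ⟨S, by simpa using h⟩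
  simp only [Finset.mem_filter, Finset.mem_powerset] at hA hmin
  refine ⟨A, hA.1, hA.2, ?_⟩
  have h1 : ∀ a : A, OnCurve k (A.erase a) := by
    intro a
    by_contra h2
    have h3 := hmin _ ⟨(Finset.erase_subset _ _).trans hA.1, h2⟩
    have h4 := Finset.card_erase_lt_of_mem a.2
    omega
  choose Q hQ0 hQ hQA using h1
  have hne : ∀ a : A, evalAt a.1 (Q a) ≠ 0 := by
    intro a h0
    refine hA.2 ⟨Q a, hQ0 a, hQ a, fun p hp => ?_⟩
    by_cases hpa : p = a
    · rwa [hpa]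
    · exact hQA a p (Finset.mem_erase.2 ⟨hpa, hp⟩)
  have hli : LinearIndependent F fun a : A => (⟨Q a, hQ a⟩ : homogeneousSubmodule (Fin 3) F k) := by
    rw [linearIndependent_iff']
    intro s c hc a ha
    have h2 := congrFun (congrArg (evalForms k A) hc) a
    rw [map_sum, Finset.sum_apply, Finset.sum_eq_single a] at h2
    · have h3 : c a = 0 ∨ evalAt a.1 (Q a) = 0 := by simpa [evalAt, smul_eval] using h2
      exact h3.resolve_right (hne a)
    · intro b _ hba
      have : evalAt a.1 (Q b) = 0 :=
        hQA b a.1 (Finset.mem_erase.2 ⟨fun h => hba (Subtype.ext h.symm), a.2⟩)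
      simp_all [evalAt, smul_eval]
    · exact fun h => (h ha).elim
  have := hli.fintype_card_le_finrank
  rwa [finrank_homogeneousSubmodule, Fintype.card_coe] at this

/-- A Cayley–Bacharach set of at most `3 * m` points, without `m + 2` collinear points and without
`2 * m + 2` points on a conic, has exactly `3 * m` points and lies on a cubic. -/
theorem IsCayleyBacharach.onCurve_three {m : ℕ} {S : Finset (ℙ F (Fin 3 → F))}
    (hS : IsCayleyBacharach m S) (hne : S.Nonempty) (hc : S.card ≤ 3 * m)
    (hl : CurveBound 1 (m + 1) S) (hq : CurveBound 2 (2 * m + 1) S) :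
    S.card = 3 * m ∧ OnCurve 3 S := by
  induction m using Nat.strong_induction_on generalizing S with
  | _ m ih =>
  have hgt := hS.lt_card hne hl hq
  suffices h : OnCurve 3 S from
    ⟨le_antisymm hc (hS.three_mul_le_card (by omega) hl hq hgt h), h⟩
  by_contra hn3
  have hn1 : ¬ OnCurve 1 S := fun h => by have := hl S subset_rfl h; omega
  have hn2 : ¬ OnCurve 2 S := fun h => by have := hq S subset_rfl h; omega
  -- The residual set of a conic with `2 * m` points is contained in a line.
  have hq1 : CurveBound 2 (2 * m - 1) S := by
    rintro T hTS ⟨Q, hQ0, hQ, hQT⟩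
    by_contra hT
    have h1 := card_residual_add_le hTS hQT
    exact hn3 (OnCurve.of_residual hQ0 hQ
      ((hS.residual_sub hQ (by omega)).onCurve_one (by omega)))
  -- The residual set of a line with `m + 1` points is contained in a line.
  have hl1 : CurveBound 1 m S := by
    rintro T hTS ⟨L, hL0, hL, hLT⟩
    by_contra hT
    have h1 := card_residual_add_le hTS hLT
    have hR := hS.residual_sub hL (by omega)
    obtain ⟨U, hUR, ⟨L', hL'0, hL', hLU⟩, hU⟩ :
        ∃ U ⊆ residualSet L S, OnCurve 1 U ∧ m < U.card := by
      by_contra! hcon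
      have := (hR.onCurve_two (residual_nonempty hL0 hL hn1) (by omega)
        fun U hU hU1 => by have := hcon U hU hU1; omega).1
      omega
    have h2 := card_residual_add_le hUR hLU
    refine hn2 (OnCurve.of_residual hL0 hL
      (OnCurve.of_residual_eq_empty hL'0 hL' fun hne' => ?_))
    have := (hR.residual_sub hL' (by omega)).card_ge hne'
    omega
  by_cases hm6 : m ≤ 6
  · -- For small `m` the cubics and the forms of degree `m - 3` impose too many conditions.
    have h10 := finrank_range_of_not_onCurve hn3
    have hm3 : 3 ≤ m := by omega
    have h4 : IsCayleyBacharach (3 + (m - 3)) S := by rwa [Nat.add_sub_cancel' hm3]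
    have h5 := h4.finrank_add_le
    have h6 : m = 3 ∨ m = 4 ∨ m = 5 ∨ m = 6 := by omega
    rcases h6 with rfl | rfl | rfl | rfl
    · exact hn3 (onCurve_of_card_lt (by norm_num [Nat.choose]; omega))
    · rw [h10, finrank_range_of_not_onCurve hn1] at h5
      norm_num [Nat.choose] at h5
      omega
    · rw [h10, finrank_range_of_not_onCurve hn2] at h5
      norm_num [Nat.choose] at h5
      omega
    · rw [h10] at h5
      norm_num [Nat.choose] at h5
      omega
  have hl2 : CurveBound 1 (m - 2) S := by
    rintro T hTS ⟨L, hL0, hL, hLT⟩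
    by_contra hT
    have h1 := card_residual_add_le hTS hLT
    have h2 := (ih (m - 1) (by omega) (hS.residual_sub hL (by omega))
      (residual_nonempty hL0 hL hn1) (by omega)
      (by rw [Nat.sub_add_cancel (by omega)]; exact hl1.mono (residual_subset _ _))
      (by
        rw [show 2 * (m - 1) + 1 = 2 * m - 1 by omega]
        exact hq1.mono (residual_subset _ _))).1
    omega
  have hq2 : CurveBound 2 (2 * m - 5) S := by
    rintro T hTS ⟨Q, hQ0, hQ, hQT⟩
    by_contra hT
    have h1 := card_residual_add_le hTS hQT
    have h2 := ((hS.residual_sub hQ (by omega)).onCurve_two (residual_nonempty hQ0 hQ hn2)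
      (by omega) fun U hU hU1 => by
        have := hl2 U (hU.trans (residual_subset _ _)) hU1; omega).1
    omega
  -- The complement of any nine points is the residual set of a cubic through these points.
  have hcompl : ∀ B ⊆ S, B.card = 9 → S.card = 3 * m ∧ OnCurve 3 (S \ B) := by
    intro B hBS hB
    obtain ⟨Q, hQ0, hQ, hQB⟩ : OnCurve 3 B :=
      onCurve_of_card_lt (by norm_num [Nat.choose]; omega)
    have h1 := card_residual_add_le hBS hQB
    obtain ⟨h2, h3⟩ := ih (m - 3) (by omega) (hS.residual_sub hQ (by omega))
      (residual_nonempty hQ0 hQ hn3) (by omega)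
      (by rw [show m - 3 + 1 = m - 2 by omega]; exact hl2.mono (residual_subset _ _))
      (by
        rw [show 2 * (m - 3) + 1 = 2 * m - 5 by omega]
        exact hq2.mono (residual_subset _ _))
    have h4 : residualSet Q S = S \ B := by
      refine Finset.eq_of_subset_of_card_le (fun p hp => ?_) ?_
      · obtain ⟨hp1, hp2⟩ := mem_residual.1 hp
        exact Finset.mem_sdiff.2 ⟨hp1, fun hpB => hp2 (hQB p hpB)⟩
      · rw [Finset.card_sdiff_of_subset hBS]
        omega
    exact ⟨by omega, h4 ▸ h3⟩
  have hcard : S.card = 3 * m := by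
    obtain ⟨B, hBS, hB⟩ := Finset.exists_subset_card_eq (show 9 ≤ S.card by omega)
    exact (hcompl B hBS hB).1
  -- At most ten points that do not lie on a cubic leave room for nine further points of `S`.
  obtain ⟨A, hAS, hA, hAc⟩ := exists_subset_not_onCurve hn3
  have hAc' : A.card ≤ 10 := hAc
  have h1 := Finset.card_sdiff_of_subset hAS
  obtain ⟨B, hBA, hB⟩ := Finset.exists_subset_card_eq (show 9 ≤ (S \ A).card by omega)
  have h2 := (hcompl B (hBA.trans Finset.sdiff_subset) hB).2
  refine hA (h2.mono fun p hp => Finset.mem_sdiff.2 ⟨hAS hp, fun hpB => ?_⟩)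
  exact (Finset.mem_sdiff.1 (hBA hpB)).2 hp

/-- Under the same hypotheses there is a curve of degree `m` through `S` without a common component
with the cubic: `S` imposes less than `3 * m` conditions on forms of degree `m`, so some form of
degree `m` through `S` is not a multiple of the cubic, and a common line or conic would contain too
many points. -/
theorem IsCayleyBacharach.exists_cubic_inter {m : ℕ} {S : Finset (ℙ F (Fin 3 → F))}
    (hS : IsCayleyBacharach m S) (hne : S.Nonempty) (hc : S.card ≤ 3 * m)
    (hl : CurveBound 1 (m + 1) S) (hq : CurveBound 2 (2 * m + 1) S) :
    S.card = 3 * m ∧ ∃ Q R : MvPolynomial (Fin 3) F, Q ≠ 0 ∧ Q.IsHomogeneous 3 ∧ R ≠ 0 ∧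
      R.IsHomogeneous m ∧ IsRelPrime Q R ∧ ∀ p ∈ S, evalAt p Q = 0 ∧ evalAt p R = 0 := by
  obtain ⟨hcard, Q, hQ0, hQ, hQS⟩ := hS.onCurve_three hne hc hl hq
  have hgt := hS.lt_card hne hl hq
  refine ⟨hcard, ?_⟩
  have hR : ∃ R : MvPolynomial (Fin 3) F,
      R.IsHomogeneous m ∧ (∀ p ∈ S, evalAt p R = 0) ∧ ¬ Q ∣ R := by
    by_contra! hcon
    have h1 := le_finrank_range_of_dvd (by omega) hQ hcon
    have h2 : IsCayleyBacharach (m + 0) S := hS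
    have h3 := h2.finrank_add_le
    have h4 : ¬ OnCurve 0 S := by
      rintro ⟨q, hq0, hq1, hqS⟩
      obtain ⟨p, hp⟩ := hne
      have h5 := totalDegree_eq_zero_iff_eq_C.1 ((totalDegree_zero_iff_isHomogeneous _).2 hq1)
      have h6 := hqS p hp
      rw [h5, evalAt, eval_C] at h6
      exact hq0 (by rw [h5, h6, map_zero])
    have h5 := finrank_range_of_not_onCurve h4
    norm_num [Nat.choose] at h5
    omega
  obtain ⟨R, hR, hRS, hQR⟩ := hR
  refine ⟨Q, R, hQ0, hQ, by rintro rfl; exact hQR (dvd_zero _), hR, ?_,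
    fun p hp => ⟨hQS p hp, hRS p hp⟩⟩
  rcases cubic_inter hQ hR hQ0 hQR hQS hRS with ⟨h, -⟩ | ⟨g, hg0, hg, -, h⟩ | ⟨g, hg0, hg, -, h⟩
  · exact h
  · have := hl.card_le hg0 hg
    omega
  · have := hq.card_le hg0 hg
    omega

/-! ### Linear subspaces of projective space and restriction to a plane -/

/-- The points of `S` lie in a linear subspace of vector space dimension at most `k`; thus they are
collinear for `k = 2` and coplanar for `k = 3`. -/
def InSubspace (k : ℕ) (S : Finset (ℙ F (Fin N → F))) : Prop :=
  ∃ W : Submodule F (Fin N → F), finrank F W ≤ k ∧ ∀ p ∈ S, p.rep ∈ W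

/-- Collinear subsets of `S` have at most `b` points. -/
def LineBound (b : ℕ) (S : Finset (ℙ F (Fin N → F))) : Prop :=
  ∀ T ⊆ S, InSubspace 2 T → T.card ≤ b

lemma LineBound.mono {b : ℕ} {S T : Finset (ℙ F (Fin N → F))} (h : LineBound b S) (hT : T ⊆ S) :
    LineBound b T :=
  fun U hU => h U (hU.trans hT)

lemma InSubspace.mono {k : ℕ} {S T : Finset (ℙ F (Fin N → F))} (h : InSubspace k S)
    (hT : T ⊆ S) : InSubspace k T :=
  h.imp fun _ hW => ⟨hW.1, fun p hp => hW.2 p (hT hp)⟩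

lemma inSubspace_of_card_le {k : ℕ} {S : Finset (ℙ F (Fin N → F))} (h : S.card ≤ k) :
    InSubspace k S := by
  refine ⟨Submodule.span F (S.image fun p => p.rep : Finset (Fin N → F)), ?_, fun p hp =>
    Submodule.subset_span (by simpa using ⟨p, hp, rfl⟩)⟩
  exact (finrank_span_finset_le_card _).trans (Finset.card_image_le.trans h)

lemma InSubspace.isCollinear {S : Finset (ℙ F (Fin N → F))} (h : InSubspace 2 S) :
    Projectivization.IsCollinear (S : Set (ℙ F (Fin N → F))) := by
  obtain ⟨W, hW, hS⟩ := h
  refine ⟨W.projectivization, ?_, ?_, fun p hp => ?_⟩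
  · rw [Projectivization.Subspace.submodule.apply_symm_apply]; infer_instance
  · rwa [Projectivization.Subspace.submodule.apply_symm_apply]
  · rw [← p.mk_rep]
    exact (Submodule.mk_mem_projectivization_iff W p.rep_nonzero).2 (hS p hp)

/-- Two lines with two common points agree. -/
lemma InSubspace.union {S T : Finset (ℙ F (Fin N → F))} (hS : InSubspace 2 S)
    (hT : InSubspace 2 T) (h : 2 ≤ (S ∩ T).card) : InSubspace 2 (S ∪ T) := by
  obtain ⟨p, hp, q, hq, hpq⟩ := Finset.one_lt_card.1 h
  rw [Finset.mem_inter] at hp hq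
  obtain ⟨W, hW, hSW⟩ := hS
  obtain ⟨W', hW', hTW'⟩ := hT
  have hli : LinearIndependent F ![p.rep, q.rep] :=
    Projectivization.linearIndependent_pair_iff_ne.2 hpq
  have h2 : finrank F (Submodule.span F (Set.range ![p.rep, q.rep])) = 2 := by
    rw [finrank_span_eq_card hli, Fintype.card_fin]
  have hle : ∀ V : Submodule F (Fin N → F), finrank F V ≤ 2 → p.rep ∈ V → q.rep ∈ V →
      Submodule.span F (Set.range ![p.rep, q.rep]) = V := by
    intro V hV h3 h4
    refine Submodule.eq_of_le_of_finrank_le ?_ (by omega)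
    rw [Submodule.span_le]
    rintro _ ⟨i, rfl⟩
    fin_cases i
    · exact h3
    · exact h4
  have e : W = W' := (hle W hW (hSW p hp.1) (hSW q hq.1)).symm.trans
    (hle W' hW' (hTW' p hp.2) (hTW' q hq.2))
  subst e
  refine ⟨W, hW, fun r hr => ?_⟩
  rcases Finset.mem_union.1 hr with hr | hr
  · exact hSW r hr
  · exact hTW' r hr

lemma exists_le_finrank_eq (W : Submodule F (Fin N → F)) (d : ℕ) (h : finrank F W + d ≤ N) :
    ∃ V : Submodule F (Fin N → F), W ≤ V ∧ finrank F V = finrank F W + d := by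
  induction d with
  | zero => exact ⟨W, le_rfl, rfl⟩
  | succ d ih =>
    obtain ⟨V, hWV, hV⟩ := ih (by omega)
    obtain ⟨v, hv⟩ : ∃ v, v ∉ V := by
      by_contra! hcon
      rw [(Submodule.eq_top_iff'.2 hcon), finrank_top, finrank_fin_fun] at hV
      omega
    exact ⟨V ⊔ Submodule.span F {v}, hWV.trans le_sup_left, by
      rw [Submodule.finrank_sup_span_singleton hv, hV, add_assoc]⟩

lemma InSubspace.exists_plane (hN : 3 ≤ N) {S : Finset (ℙ F (Fin N → F))} (h : InSubspace 3 S) :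
    ∃ (φ : (Fin 3 → F) →ₗ[F] (Fin N → F)) (hφ : Function.Injective φ)
      (S' : Finset (ℙ F (Fin 3 → F))), S'.image (Projectivization.map φ hφ) = S := by
  obtain ⟨W, hW, hSW⟩ := h
  obtain ⟨V, hWV, hV⟩ : ∃ V : Submodule F (Fin N → F), W ≤ V ∧ finrank F V = 3 := by
    obtain ⟨V, h1, h2⟩ := exists_le_finrank_eq W (3 - finrank F W) (by omega)
    exact ⟨V, h1, by omega⟩
  let e : (Fin 3 → F) ≃ₗ[F] V := LinearEquiv.ofFinrankEq _ _ (by simp [hV])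
  have hφ : Function.Injective (V.subtype.comp e.toLinearMap) :=
    V.subtype_injective.comp e.injective
  refine ⟨V.subtype.comp e.toLinearMap, hφ,
    S.preimage _ (Projectivization.map_injective _ hφ).injOn, ?_⟩
  rw [Finset.image_preimage, Finset.filter_true_of_mem]
  intro p hp
  have hv : e.symm ⟨p.rep, hWV (hSW p hp)⟩ ≠ 0 := by
    rw [ne_eq, LinearEquiv.map_eq_zero_iff, Submodule.mk_eq_zero]
    exact p.rep_nonzero
  refine ⟨Projectivization.mk F _ hv, ?_⟩
  rw [Projectivization.map_mk]
  conv_rhs => rw [← p.mk_rep]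
  congr 1
  simp

lemma exists_rep_map {φ : (Fin 3 → F) →ₗ[F] (Fin N → F)} (hφ : Function.Injective φ)
    (p : ℙ F (Fin 3 → F)) :
    ∃ c : F, c ≠ 0 ∧ (Projectivization.map φ hφ p).rep = c • φ p.rep := by
  have h : φ p.rep ≠ 0 := by
    rw [ne_eq, map_eq_zero_iff _ hφ]
    exact p.rep_nonzero
  obtain ⟨a, ha⟩ := Projectivization.exists_smul_eq_mk_rep F (φ p.rep) h
  refine ⟨a, a.ne_zero, ?_⟩
  conv_lhs => rw [← p.mk_rep, Projectivization.map_mk]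
  exact ha.symm

lemma eval_smul_of_isHomogeneous {m : ℕ} {q : MvPolynomial (Fin N) F} (hq : q.IsHomogeneous m)
    (c : F) (x : Fin N → F) : eval (c • x) q = c ^ m * eval x q := by
  rw [eval_eq', eval_eq', Finset.mul_sum]
  refine Finset.sum_congr rfl fun d hd => ?_
  have h : ∑ i, d i = m := by
    rw [← Finsupp.degree_eq_sum]
    by_contra hne
    exact mem_support_iff.1 hd (hq.coeff_eq_zero hne)
  simp only [Pi.smul_apply, smul_eq_mul, mul_pow, Finset.prod_mul_distrib,
    Finset.prod_pow_eq_pow_sum, h]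
  ring

/-- Restricting forms to a plane: every ternary form extends to the ambient space. -/
lemma IsCayleyBacharach.of_image {m : ℕ} {φ : (Fin 3 → F) →ₗ[F] (Fin N → F)}
    (hφ : Function.Injective φ) {S : Finset (ℙ F (Fin 3 → F))}
    (hS : IsCayleyBacharach m (S.image (Projectivization.map φ hφ))) :
    IsCayleyBacharach m S := by
  obtain ⟨w, hw, h⟩ := hS
  choose c hc0 hc using exists_rep_map (F := F) hφ
  obtain ⟨π, hπ⟩ := φ.exists_leftInverse_of_injective (LinearMap.ker_eq_bot.2 hφ)
  refine ⟨fun p => w (Projectivization.map φ hφ p) * c p ^ m, fun p hp => ?_, fun q hq => ?_⟩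
  · exact mul_ne_zero (hw _ (Finset.mem_image_of_mem _ hp)) (pow_ne_zero _ (hc0 p))
  · let l : Fin 3 → MvPolynomial (Fin N) F := fun j => ∑ i, C (π (Pi.single i 1) j) * X i
    have hl : ∀ x j, eval x (l j) = π x j := by
      intro x j
      conv_rhs => rw [pi_eq_sum_univ' x]
      simp [l, mul_comm]
    have hlq : ∀ (p : MvPolynomial (Fin 3) F) (x), eval x (aeval l p) = eval (π x) p := by
      intro p x
      induction p using MvPolynomial.induction_on with
      | C a => simp
      | add p q hp hq => rw [map_add, map_add, hp, hq, map_add]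
      | mul_X p j hp => rw [map_mul, map_mul, hp, aeval_X, hl, map_mul, eval_X]
    have h1 := h (aeval l q) (by
      have := hq.aeval l (n := 1) fun j =>
        IsHomogeneous.sum _ _ _ fun i _ => isHomogeneous_C_mul_X _ _
      rwa [one_mul] at this)
    rw [Finset.sum_image (Projectivization.map_injective φ hφ).injOn] at h1
    rw [← h1]
    refine Finset.sum_congr rfl fun p _ => ?_
    have h2 : eval (Projectivization.map φ hφ p).rep (aeval l q) = c p ^ m * eval p.rep q := by
      have h4 : π (φ p.rep) = p.rep := LinearMap.congr_fun hπ p.rep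
      rw [hlq, hc, map_smul, h4, eval_smul_of_isHomogeneous hq]
    rw [evalAt, evalAt, h2]
    ring

lemma OnCurve.inSubspace_image {φ : (Fin 3 → F) →ₗ[F] (Fin N → F)} (hφ : Function.Injective φ)
    {T : Finset (ℙ F (Fin 3 → F))} (h : OnCurve 1 T) :
    InSubspace 2 (T.image (Projectivization.map φ hφ)) := by
  obtain ⟨L, hL0, hL, hLT⟩ := h
  have h1 : L ∈ Submodule.span F (Set.range (X : Fin 3 → MvPolynomial (Fin 3) F)) := by
    rw [← homogeneousSubmodule_one_eq_span_X]; exact hL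
  obtain ⟨a, ha⟩ := (Submodule.mem_span_range_iff_exists_fun F).1 h1
  let ψ : (Fin 3 → F) →ₗ[F] F := Fintype.linearCombination F a
  have hψ : ∀ x, eval x L = ψ x := by
    intro x
    simp [← ha, ψ, Fintype.linearCombination_apply, smul_eval, mul_comm]
  have hψ0 : ψ ≠ 0 := by
    intro h0
    apply hL0
    rw [← ha]
    refine Finset.sum_eq_zero fun i _ => ?_
    have : a i = 0 := by simpa [ψ] using LinearMap.congr_fun h0 (Pi.single i 1)
    rw [this, zero_smul]
  have h2 : finrank F (LinearMap.ker ψ) = 2 := by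
    have h3 := LinearMap.finrank_range_add_finrank_ker ψ
    rw [LinearMap.range_eq_top.2 (LinearMap.surjective hψ0)] at h3
    simp at h3
    omega
  refine ⟨(LinearMap.ker ψ).map φ, (Submodule.finrank_map_le _ _).trans h2.le, ?_⟩
  intro q hq
  obtain ⟨p, hp, rfl⟩ := Finset.mem_image.1 hq
  obtain ⟨c, -, hc⟩ := exists_rep_map hφ p
  rw [hc]
  refine Submodule.smul_mem _ _ ⟨p.rep, ?_, rfl⟩
  change ψ p.rep = 0
  rw [← hψ]
  exact hLT p hp

lemma LineBound.curveBound {b : ℕ} {φ : (Fin 3 → F) →ₗ[F] (Fin N → F)} (hφ : Function.Injective φ)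
    {S : Finset (ℙ F (Fin 3 → F))} (h : LineBound b (S.image (Projectivization.map φ hφ))) :
    CurveBound 1 b S := by
  intro T hT hT1
  rw [← Finset.card_image_of_injective T (Projectivization.map_injective φ hφ)]
  exact h _ (Finset.image_subset_image hT) (hT1.inSubspace_image hφ)

/-! ### Cayley–Bacharach sets with few points are coplanar -/

lemma IsCayleyBacharach.exists_off_subspace {m k : ℕ} {S : Finset (ℙ F (Fin N → F))}
    (hS : IsCayleyBacharach (m + 1) S) (hk : ¬ InSubspace k S) {W : Submodule F (Fin N → F)}
    (hW : finrank F W ≤ k) :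
    ∃ R ⊆ S, IsCayleyBacharach m R ∧ m + 2 ≤ R.card ∧ ∀ q ∈ R, q.rep ∉ W := by
  obtain ⟨p, hp, hpW⟩ : ∃ p ∈ S, p.rep ∉ W := by
    by_contra! hcon
    exact hk ⟨W, hW, hcon⟩
  obtain ⟨R, hRS, hpR, hR, hRW⟩ := hS.exists_off hp hpW
  exact ⟨R, hRS, hR, hR.card_ge ⟨p, hpR⟩, hRW⟩

lemma card_add_card_le_of_rep {R T S : Finset (ℙ F (Fin N → F))} {W : Submodule F (Fin N → F)}
    (hRS : R ⊆ S) (hTS : T ⊆ S) (hR : ∀ q ∈ R, q.rep ∉ W) (hT : ∀ q ∈ T, q.rep ∈ W) :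
    R.card + T.card ≤ S.card := by
  rw [← Finset.card_union_of_disjoint]
  · exact Finset.card_le_card (Finset.union_subset hRS hTS)
  · rw [Finset.disjoint_left]
    exact fun p hp hpT => hR p hp (hT p hpT)

lemma IsCayleyBacharach.inSubspace_two {m : ℕ} {S : Finset (ℙ F (Fin N → F))}
    (hS : IsCayleyBacharach m S) (hc : S.card ≤ m + 2) : InSubspace 2 S := by
  by_cases h2 : S.card ≤ 2
  · exact inSubspace_of_card_le h2
  by_contra hn
  obtain ⟨T, hTS, hT⟩ := Finset.exists_subset_card_eq (show 2 ≤ S.card by omega)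
  obtain ⟨W, hW, hTW⟩ := inSubspace_of_card_le hT.le
  obtain ⟨j, rfl⟩ := Nat.exists_eq_add_of_le' (show 1 ≤ m by omega)
  obtain ⟨R, hRS, -, hR, hRW⟩ := hS.exists_off_subspace hn hW
  have := card_add_card_le_of_rep hRS hTS hRW hTW
  omega

lemma IsCayleyBacharach.two_mul_le_card (hN : 3 ≤ N) {m : ℕ} {S : Finset (ℙ F (Fin N → F))}
    (hS : IsCayleyBacharach m S) (hne : S.Nonempty) (hl : LineBound (m + 1) S)
    (h3 : InSubspace 3 S) : 2 * m + 2 ≤ S.card := by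
  obtain ⟨φ, hφ, S', rfl⟩ := h3.exists_plane hN
  have hcard := Finset.card_image_of_injective S' (Projectivization.map_injective φ hφ)
  by_contra hlt
  have := ((IsCayleyBacharach.of_image hφ hS).onCurve_two (by simpa using hne) (by omega)
    (hl.curveBound hφ)).1
  omega

/-- A Cayley–Bacharach set with at most `3 * m` or at most `2 * m + 2` points, no `m + 2` of which
are collinear, lies in a plane. Otherwise removing a hyperplane through three non-collinear points
produces a line `L` with `m + 1` points, and removing hyperplanes that contain `L` and one more
point produces two further lines with `m + 1` points each, which is too much. -/
theorem IsCayleyBacharach.inSubspace_three (hN : 3 ≤ N) {m : ℕ} {S : Finset (ℙ F (Fin N → F))}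
    (hS : IsCayleyBacharach m S) (hc : S.card ≤ 3 * m ∨ S.card ≤ 2 * m + 2)
    (hl : LineBound (m + 1) S) : InSubspace 3 S := by
  induction m generalizing S with
  | zero => exact inSubspace_of_card_le (by omega)
  | succ m ih =>
  by_contra hn
  have h4 : 3 < S.card := by
    by_contra h
    exact hn (inSubspace_of_card_le (by omega))
  -- A residual set without `m + 2` collinear points is coplanar and has `2 * m + 2` points.
  have hline : ∀ R ⊆ S, IsCayleyBacharach m R → m + 2 ≤ R.card → R.card + 3 ≤ S.card →
      ∃ T ⊆ R, InSubspace 2 T ∧ m + 2 ≤ T.card := by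
    intro R hRS hR hRc hRS3
    by_contra! hcon
    have hlR : LineBound (m + 1) R := fun T hT hT2 => by have := hcon T hT hT2; omega
    have h3 := ih hR (by omega) hlR
    have h5 := hR.two_mul_le_card hN (Finset.card_pos.1 (by omega)) hlR h3
    obtain ⟨W, hW, hRW⟩ := h3
    obtain ⟨R', hRS', -, hR', hRW'⟩ := hS.exists_off_subspace hn hW
    have := card_add_card_le_of_rep hRS' hRS hRW' hRW
    omega
  obtain ⟨T, hTS, hT2, hTc⟩ : ∃ T ⊆ S, InSubspace 2 T ∧ m + 2 ≤ T.card := by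
    obtain ⟨U, hUS, hU⟩ := Finset.exists_subset_card_eq (show 3 ≤ S.card by omega)
    obtain ⟨W, hW, hUW⟩ := inSubspace_of_card_le hU.le
    obtain ⟨R, hRS, hR, hRc, hRW⟩ := hS.exists_off_subspace hn hW
    have := card_add_card_le_of_rep hRS hUS hRW hUW
    obtain ⟨T, hT, h⟩ := hline R hRS hR hRc (by omega)
    exact ⟨T, hT.trans hRS, h⟩
  obtain ⟨L, hL, hTL⟩ := hT2
  have hoff : ∀ a ∈ S, a.rep ∉ L → ∃ T' ⊆ S, InSubspace 2 T' ∧ m + 2 ≤ T'.card ∧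
      (∀ q ∈ T', q.rep ∉ L) ∧ a ∉ T' := by
    intro a ha haL
    have hW : finrank F (L ⊔ Submodule.span F {a.rep} : Submodule F (Fin N → F)) ≤ 3 := by
      rw [Submodule.finrank_sup_span_singleton haL]
      omega
    have haW : a.rep ∈ L ⊔ Submodule.span F {a.rep} :=
      Submodule.mem_sup_right (Submodule.mem_span_singleton_self _)
    obtain ⟨R, hRS, hR, hRc, hRW⟩ := hS.exists_off_subspace hn hW
    have h1 := card_add_card_le_of_rep hRS (Finset.insert_subset ha hTS) hRW fun q hq => by
      rcases Finset.mem_insert.1 hq with rfl | hq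
      · exact haW
      · exact Submodule.mem_sup_left (hTL q hq)
    rw [Finset.card_insert_of_notMem fun h => haL (hTL a h)] at h1
    obtain ⟨T', hT', h2, h3⟩ := hline R hRS hR hRc (by omega)
    exact ⟨T', hT'.trans hRS, h2, h3, fun q hq hqL => hRW q (hT' hq) (Submodule.mem_sup_left hqL),
      fun h => hRW a (hT' h) haW⟩
  obtain ⟨a, ha, haL⟩ : ∃ a ∈ S, a.rep ∉ L := by
    by_contra! hcon
    exact hn ⟨L, by omega, hcon⟩
  obtain ⟨T₁, hT₁S, hT₁, hT₁c, hT₁L, -⟩ := hoff a ha haL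
  obtain ⟨b, hb⟩ := Finset.card_pos.1 (show 0 < T₁.card by omega)
  obtain ⟨T₂, hT₂S, hT₂, hT₂c, hT₂L, hbT₂⟩ := hoff b (hT₁S hb) (hT₁L b hb)
  by_cases hint : 2 ≤ (T₁ ∩ T₂).card
  · have h1 := hl _ (Finset.union_subset hT₁S hT₂S) (hT₁.union hT₂ hint)
    have h2 : (insert b T₂).card ≤ (T₁ ∪ T₂).card :=
      Finset.card_le_card (Finset.insert_subset (Finset.mem_union_left _ hb)
        Finset.subset_union_right)
    rw [Finset.card_insert_of_notMem hbT₂] at h2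
    omega
  · have h1 := Finset.card_union_add_card_inter T₁ T₂
    have h2 := card_add_card_le_of_rep (Finset.union_subset hT₁S hT₂S) hTS (fun q hq => by
      rcases Finset.mem_union.1 hq with hq | hq
      · exact hT₁L q hq
      · exact hT₂L q hq) hTL
    omega

/-! ### From codewords to Cayley–Bacharach sets -/

/-- The support of a word of the dual code carries a Cayley–Bacharach relation: the functions
`h / (s / t)` with `h` a form of degree `m` belong to `L(G)`, so `x i * t (P i) / s (P i)` are the
coefficients of a relation. -/
lemma isCayleyBacharach_support {r c n : ℕ} {f : Fin c → MvPolynomial (Fin (r + 1)) F} {m : ℕ}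
    {G : Divisor f} {P : Fin n → ℙ F (Fin (r + 1) → F)} (hP : Function.Injective P)
    (hL : ContainsForms P G m) {x : Fin n → F} (hx : x ∈ dualCode (agCode P G))
    {T : Finset (ℙ F (Fin (r + 1) → F))} (hT : (T : Set _) = P '' {i | x i ≠ 0}) :
    IsCayleyBacharach m T := by
  obtain rfl : T = (Finset.univ.filter fun i => x i ≠ 0).image P :=
    Finset.coe_injective (by rw [hT]; simp)
  obtain ⟨k, s, t, -, -, -, -, hst, hz⟩ := hL
  let w : Fin n → F := fun i => x i * (evalAt (P i) t / evalAt (P i) s)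
  refine ⟨Function.extend P w 0, fun p hp => ?_, fun h hh => ?_⟩
  · obtain ⟨i, hi, rfl⟩ := Finset.mem_image.1 hp
    rw [hP.extend_apply]
    exact mul_ne_zero (Finset.mem_filter.1 hi).2 (div_ne_zero (hst i).2 (hst i).1)
  · obtain ⟨z, hzG, hzf⟩ := hz h hh
    have h1 : (fun i => evalAt (P i) (h * t) / evalAt (P i) s) ∈ agCode P G :=
      ⟨z, hzG, fun i => ⟨h * t, s, hzf, (hst i).1, rfl⟩⟩
    have h2 : ∑ i, x i * (evalAt (P i) (h * t) / evalAt (P i) s) = 0 := hx _ h1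
    rw [Finset.sum_image hP.injOn, Finset.sum_filter_of_ne, ← h2]
    · refine Finset.sum_congr rfl fun i _ => ?_
      simp only [hP.extend_apply, w, evalAt, map_mul]
      ring
    · intro i _ h3 h4
      exact h3 (by simp [hP.extend_apply, w, h4])

lemma planeCurve_of_evalAt {r : ℕ} {φ : (Fin 3 → F) →ₗ[F] (Fin (r + 1) → F)}
    (hφ : Function.Injective φ) {Q : MvPolynomial (Fin 3) F} {T : Finset (ℙ F (Fin 3 → F))}
    (h : ∀ p ∈ T, evalAt p Q = 0) :
    ((T.image (Projectivization.map φ hφ) : Finset _) : Set (ℙ F (Fin (r + 1) → F))) ⊆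
      planeCurve φ hφ Q := by
  rw [Finset.coe_image]
  exact Set.image_mono fun p hp => h p hp

lemma OnCurve.onPlaneConic {r : ℕ} {φ : (Fin 3 → F) →ₗ[F] (Fin (r + 1) → F)}
    (hφ : Function.Injective φ) {T : Finset (ℙ F (Fin 3 → F))} (h : OnCurve 2 T) :
    OnPlaneConic ((T.image (Projectivization.map φ hφ) : Finset _) :
      Set (ℙ F (Fin (r + 1) → F))) := by
  obtain ⟨Q, hQ0, hQ, hQT⟩ := h
  exact ⟨φ, hφ, Q, hQ0, hQ, planeCurve_of_evalAt hφ hQT⟩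

lemma lineBound_of_ncard {b : ℕ} {S : Finset (ℙ F (Fin N → F))}
    (h : ∀ T ⊆ (S : Set (ℙ F (Fin N → F))), T.ncard = b + 1 → ¬ Projectivization.IsCollinear T) :
    LineBound b S := by
  intro T hT hT2
  by_contra hlt
  obtain ⟨U, hUT, hU⟩ := Finset.exists_subset_card_eq (show b + 1 ≤ T.card by omega)
  exact h U (Finset.coe_subset.2 (hUT.trans hT)) (by rw [Set.ncard_coe_finset, hU])
    (hT2.mono hUT).isCollinear

lemma curveBound_of_ncard {r b : ℕ} {φ : (Fin 3 → F) →ₗ[F] (Fin (r + 1) → F)}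
    (hφ : Function.Injective φ) {S : Finset (ℙ F (Fin 3 → F))}
    (h : ∀ T ⊆ ((S.image (Projectivization.map φ hφ) : Finset _) : Set (ℙ F (Fin (r + 1) → F))),
      T.ncard = b + 1 → ¬ OnPlaneConic T) :
    CurveBound 2 b S := by
  intro T hT hT2
  by_contra hlt
  obtain ⟨U, hUT, hU⟩ := Finset.exists_subset_card_eq (show b + 1 ≤ T.card by omega)
  refine h _ (Finset.coe_subset.2 (Finset.image_subset_image (hUT.trans hT))) ?_
    ((hT2.mono hUT).onPlaneConic hφ)
  rw [Set.ncard_coe_finset, Finset.card_image_of_injective U (Projectivization.map_injective φ hφ),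
    hU]

/-- The three cases for an arbitrary Cayley–Bacharach set: codes and divisors enter only through
`isCayleyBacharach_support`. -/
theorem IsCayleyBacharach.trichotomy {r m : ℕ} (hr : 2 ≤ r) {S : Finset (ℙ F (Fin (r + 1) → F))}
    (hS : IsCayleyBacharach m S) (hne : S.Nonempty) :
    (S.card ≤ m + 2 →
      S.card = m + 2 ∧ Projectivization.IsCollinear (S : Set (ℙ F (Fin (r + 1) → F)))) ∧
    (S.card ≤ 2 * m + 2 →
      (∀ T ⊆ (S : Set (ℙ F (Fin (r + 1) → F))), T.ncard = m + 2 →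
        ¬ Projectivization.IsCollinear T) →
      S.card = 2 * m + 2 ∧ OnPlaneConic (S : Set (ℙ F (Fin (r + 1) → F)))) ∧
    (S.card ≤ 3 * m →
      (∀ T ⊆ (S : Set (ℙ F (Fin (r + 1) → F))), T.ncard = m + 2 →
        ¬ Projectivization.IsCollinear T) →
      (∀ T ⊆ (S : Set (ℙ F (Fin (r + 1) → F))), T.ncard = 2 * m + 2 → ¬ OnPlaneConic T) →
      S.card = 3 * m ∧ OnCubicInter (S : Set (ℙ F (Fin (r + 1) → F))) m) := by
  have hN : 3 ≤ r + 1 := by omega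
  refine ⟨fun hc => ⟨le_antisymm hc (hS.card_ge hne), (hS.inSubspace_two hc).isCollinear⟩,
    fun hc hline => ?_, fun hc hline hconic => ?_⟩
  · have hl : LineBound (m + 1) S := lineBound_of_ncard hline
    obtain ⟨φ, hφ, S', rfl⟩ := (hS.inSubspace_three hN (Or.inr hc) hl).exists_plane hN
    have hcard := Finset.card_image_of_injective S' (Projectivization.map_injective φ hφ)
    obtain ⟨h1, h2⟩ := (IsCayleyBacharach.of_image hφ hS).onCurve_two (by simpa using hne)
      (by omega) (hl.curveBound hφ)
    exact ⟨by omega, h2.onPlaneConic hφ⟩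
  · have hl : LineBound (m + 1) S := lineBound_of_ncard hline
    obtain ⟨φ, hφ, S', rfl⟩ := (hS.inSubspace_three hN (Or.inl hc) hl).exists_plane hN
    have hcard := Finset.card_image_of_injective S' (Projectivization.map_injective φ hφ)
    obtain ⟨h1, Q, R, hQ0, hQ, hR0, hR, hQR, hv⟩ :=
      (IsCayleyBacharach.of_image hφ hS).exists_cubic_inter (by simpa using hne) (by omega)
        (hl.curveBound hφ) (curveBound_of_ncard hφ hconic)
    exact ⟨by omega, φ, hφ, Q, R, hQ0, hQ, hR0, hR, hQR, Set.subset_inter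
      (planeCurve_of_evalAt hφ fun p hp => (hv p hp).1)
      (planeCurve_of_evalAt hφ fun p hp => (hv p hp).2)⟩

end DualAGCode

end

theorem theorem1 {F : Type*} [Field F] [Fintype F] [DecidableEq F]
    {r c n : ℕ} (hr : 2 ≤ r) (m : ℕ)
    (f : Fin c → MvPolynomial (Fin (r + 1)) F) (hX : DualAGCode.IsSmoothConnectedCI f)
    (G : DualAGCode.Divisor f)
    (P : Fin n → Projectivization F (Fin (r + 1) → F)) (hPinj : Function.Injective P)
    (hPX : ∀ i, DualAGCode.IsPointOf f (P i))
    (hPG : ∀ i, DualAGCode.Avoids (P i) G)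
    (hL : DualAGCode.ContainsForms P G m)
    (d : ℕ) (hd : d = DualAGCode.minDist (DualAGCode.dualCode (DualAGCode.agCode P G)))
    (x : Fin n → F)
    (hx : DualAGCode.IsMinWeight (DualAGCode.dualCode (DualAGCode.agCode P G)) x)
    (S : Set (Projectivization F (Fin (r + 1) → F))) (hS : S = P '' {i | x i ≠ 0}) :
    (d ≤ m + 2 → d = m + 2 ∧ Projectivization.IsCollinear S) ∧
    (d ≤ 2 * m + 2 →
      (∀ T ⊆ S, T.ncard = m + 2 → ¬ Projectivization.IsCollinear T) →
      d = 2 * m + 2 ∧ DualAGCode.OnPlaneConic S) ∧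
    (d ≤ 3 * m →
      (∀ T ⊆ S, T.ncard = m + 2 → ¬ Projectivization.IsCollinear T) →
      (∀ T ⊆ S, T.ncard = 2 * m + 2 → ¬ DualAGCode.OnPlaneConic T) →
      d = 3 * m ∧ DualAGCode.OnCubicInter S m) := by
  obtain ⟨hxC, hx0, hxd⟩ := hx
  have hT : ((Set.toFinite S).toFinset : Set _) = P '' {i | x i ≠ 0} := by
    rw [Set.Finite.coe_toFinset, hS]
  have hcard : (Set.toFinite S).toFinset.card = d := by
    rw [← Set.ncard_eq_toFinset_card, hS, Set.ncard_image_of_injective _ hPinj, hd, ← hxd,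
      hammingNorm, ← Set.ncard_coe_finset]
    simp
  have hne : (Set.toFinite S).toFinset.Nonempty := by
    obtain ⟨i, hi⟩ := Function.ne_iff.1 hx0
    rw [Set.Finite.toFinset_nonempty, hS]
    exact ⟨P i, i, hi, rfl⟩
  have key := (DualAGCode.isCayleyBacharach_support hPinj hL hxC hT).trichotomy hr hne
  rw [hcard, Set.Finite.coe_toFinset] at key
  exact key
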